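/- **Theorem.** The problem *Colored Path*, parameterized by $k$, is in the class $\mathsf{W[P]}$. Here an input of Colored Path consists of a planar simple graph $G=(V,E)$, a finite set $C$ of colors, a map $\chi : V \to 2^{C}$, and two vertices $s,t\in V$; the parameter is $k\in\mathbb{N}$, and the question is whether $G$ has an $s$-$t$ path $P=(s=v_0,\dots,v_r=t)$ with $\bigl|\bigcup_{i=0}^{r}\chi(v_i)\bigr|\le k$. A parameterized problem $Q$ is *fpt-reducible* to a parameterized problem $Q'$ if there is an algorithm (a Turing machine) that transforms each instance $(x,k)$ of $Q$ into an instance $(x',k')$ of $Q'$ in time $f(k)\cdot |x|^{O(1)}$, such that $k'\le g(k)$ and $(x,k)\in Q$ if and only if $(x',k')\in Q'$, where $f,g:\mathbb{N}\to\mathbb{N}$ are computable functions. $\mathsf{W[P]}$ is the class of all parameterized problems that are fpt-reducible to *Weighted Boolean Circuit Satisfiability*: given a Boolean circuit $B$ (a finite directed acyclic graph whose vertices of indegree $0$ are labelled by positive or negative literals, whose other vertices are AND- or OR-gates of arbitrary fan-in, and in which one gate of outdegree $0$ is the output) and the parameter $k\in\mathbb{N}$, is there a truth assignment to the variables of $B$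 that satisfies $B$ and sets exactly $k$ variables to $1$? -/

import Mathlib

/-! ## Parameterized problems, fpt-reductions -/

/-- A parameterized problem over a finite alphabet `Symbol`. An instance is a pair `(x, k)`, where
`x = code I` is the string encoding an input `I`, and `k : ℕ` is the parameter. As a set of pairs
it is `{(code I, k) | Yes I k} ⊆ Symbol* × ℕ`; the strings that are the code of some input are the
legal inputs of the problem. -/
structure ParamProblem where
  Symbol : Type
  [symbolFintype : Fintype Symbol]
  Input : Type
  code : Input → List Symbol
  code_injective : Function.Injective code
  Yes : Input → ℕ → Prop

namespace ParamProblem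

/-- The string `1^k x` over `Symbol` extended by the extra symbol `1` (here `none`): the pair
`(x, k)` as it is written on the input or output tape of a machine. -/
def tape (P : ParamProblem) (I : P.Input) (k : ℕ) : List (Option P.Symbol) :=
  List.replicate k none ++ (P.code I).map some

/-- `P` is fpt-reducible to `Q`: a (multi-stack Turing) machine `M` transforms each instance `(x, k)`
of `P` into an instance `(x', k')` of `Q` within `f(k) * (|x| + 1) ^ c` steps, where `k' ≤ g(k)`, and
`(x, k)` is a yes-instance of `P` iff `(x', k')` is a yes-instance of `Q`; `f`, `g` are computable.
(`|x| + 1` instead of `|x|` matters only for the empty string.) -/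
def FPTReducible (P Q : ParamProblem) : Prop :=
  ∃ (M : Turing.TM2ComputableAux (Option P.Symbol) (Option Q.Symbol)) (f g : ℕ → ℕ) (c : ℕ),
    Computable f ∧ Computable g ∧
    ∀ (I : P.Input) (k : ℕ), ∃ (I' : Q.Input) (k' : ℕ),
      Nonempty (Turing.TM2OutputsInTime M.tm
        ((P.tape I k).map M.inputAlphabet.symm)
        (some ((Q.tape I' k').map M.outputAlphabet.symm))
        (f k * ((P.code I).length + 1) ^ c)) ∧
      k' ≤ g k ∧
      (P.Yes I k ↔ Q.Yes I' k')

end ParamProblem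

/-! ## Boolean circuits and the class W[P] -/

/-- A vertex of a Boolean circuit: an input vertex labelled by the literal `x_i` (`lit true i`) or
its negation (`lit false i`), or an AND/OR gate with the list of its in-neighbours. -/
inductive CircuitNode where
  | lit (positive : Bool) (i : ℕ)
  | and (inputs : List ℕ)
  | or (inputs : List ℕ)

namespace CircuitNode

def inputs : CircuitNode → List ℕ
  | lit _ _ => []
  | and l => l
  | or l => l

def IsGate : CircuitNode → Prop
  | lit _ _ => False
  | and _ => True
  | or _ => True

end CircuitNode

/-- A Boolean circuit: a finite acyclic simple digraph, whose vertices `0, …, N - 1` are listed in a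
topological order that ends with the output gate (which hence has outdegree `0`). The vertices of
indegree `0` are exactly the ones labelled by literals; the others are AND/OR gates. -/
structure BoolCircuit where
  nodes : List CircuitNode
  inputs_lt : ∀ (i : ℕ) (h : i < nodes.length), ∀ j ∈ nodes[i].inputs, j < i
  inputs_nodup : ∀ v ∈ nodes, v.inputs.Nodup
  gate_inputs_ne_nil : ∀ v ∈ nodes, v.IsGate → v.inputs ≠ []
  output_isGate : ∃ v, nodes.getLast? = some v ∧ v.IsGate

namespace BoolCircuit

/-- The value of the vertex `i` under the assignment that sets exactly the variables in `S` to `1`.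
(The side conditions `j < i` always hold, by `inputs_lt`.) -/
def Value (C : BoolCircuit) (S : Finset ℕ) (i : ℕ) : Prop :=
  match C.nodes[i]? with
  | none => False
  | some (.lit true x) => x ∈ S
  | some (.lit false x) => x ∉ S
  | some (.and l) => ∀ j ∈ l, ∃ _ : j < i, Value C S j
  | some (.or l) => ∃ j ∈ l, ∃ _ : j < i, Value C S j
termination_by i

/-- The indices of the variables of the circuit. -/
def vars (C : BoolCircuit) : Set ℕ := {x | ∃ b, CircuitNode.lit b x ∈ C.nodes}

/-- `C` has a satisfying assignment of weight exactly `k`. -/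
def WeightedSat (C : BoolCircuit) (k : ℕ) : Prop :=
  ∃ S : Finset ℕ, (S : Set ℕ) ⊆ C.vars ∧ S.card = k ∧ C.Value S (C.nodes.length - 1)

end BoolCircuit

/-- The alphabet in which circuits are encoded. -/
inductive CircuitSymbol where
  | pos | neg | and | or | sep | one
  deriving DecidableEq

instance : Fintype CircuitSymbol :=
  ⟨{.pos, .neg, .and, .or, .sep, .one}, fun x => by cases x <;> simp⟩

/-- The code of a vertex: its label, followed by the index of its variable in unary, or by the
indices of its in-neighbours in unary. -/
def CircuitNode.code : CircuitNode → List CircuitSymbol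
  | lit true i => .pos :: List.replicate i .one
  | lit false i => .neg :: List.replicate i .one
  | and l => .and :: l.flatMap fun j => .sep :: List.replicate j .one
  | or l => .or :: l.flatMap fun j => .sep :: List.replicate j .one

def BoolCircuit.code (C : BoolCircuit) : List CircuitSymbol :=
  C.nodes.flatMap CircuitNode.code

section CircuitCode

variable {α : Type*}

/-- Unique splitting of a list at its first symbol outside of `p`. -/
theorem List.append_inj_of_all (p : α → Prop) {a b c d : List α} (ha : ∀ x ∈ a, p x)
    (hb : ∀ x ∈ b, p x) (hc : ∀ x ∈ c.head?, ¬ p x) (hd : ∀ x ∈ d.head?, ¬ p x)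
    (h : a ++ c = b ++ d) : a = b ∧ c = d := by
  induction a generalizing b with
  | nil =>
    cases b with
    | nil => exact ⟨rfl, h⟩
    | cons y b => subst h; exact absurd (hb y (by simp)) (hc y (by simp))
  | cons x a ih =>
    cases b with
    | nil =>
      simp only [List.nil_append] at h
      subst h; exact absurd (ha x (by simp)) (hd x (by simp))
    | cons y b =>
      simp only [List.cons_append, List.cons.injEq] at h
      obtain ⟨rfl, h⟩ := h
      obtain ⟨rfl, rfl⟩ := ih (b := b) (fun z hz => ha z (by simp [hz]))
        (fun z hz => hb z (by simp [hz])) h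
      exact ⟨rfl, rfl⟩

/-- A concatenation of blocks, each of them a header outside of `p` followed by symbols in `p`,
determines its blocks. -/
theorem List.flatMap_injective_of_header {β : Type*} (p : α → Prop) (f : β → List α)
    (hf : Function.Injective f)
    (hp : ∀ b, ∃ x l, f b = x :: l ∧ ¬ p x ∧ ∀ y ∈ l, p y) :
    Function.Injective fun l : List β => l.flatMap f := by
  have hh : ∀ l : List β, ∀ x ∈ (l.flatMap f).head?, ¬ p x := by
    intro l x hx
    cases l with
    | nil => simp at hx
    | cons b l =>
      obtain ⟨y, t, e, hy, -⟩ := hp b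
      simp [List.flatMap_cons, e] at hx
      exact hx ▸ hy
  intro l
  induction l with
  | nil =>
    intro m h
    cases m with
    | nil => rfl
    | cons b m => obtain ⟨y, t, e, -⟩ := hp b; simp [e] at h
  | cons a l ih =>
    intro m h
    cases m with
    | nil => obtain ⟨y, t, e, -⟩ := hp a; simp [e] at h
    | cons b m =>
      obtain ⟨x, s, e, hx, hs⟩ := hp a
      obtain ⟨y, t, e', hy, ht⟩ := hp b
      simp only [List.flatMap_cons, e, e', List.cons_append, List.cons.injEq] at h
      obtain ⟨h1, h2⟩ := List.append_inj_of_all p hs ht (hh l) (hh m) h.2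
      rw [hf (e.trans ((congrArg₂ List.cons h.1 h1).trans e'.symm)), ih h2]

theorem CircuitNode.code_injective : Function.Injective CircuitNode.code := by
  have key : Function.Injective fun l : List ℕ =>
      l.flatMap fun j => CircuitSymbol.sep :: List.replicate j CircuitSymbol.one := by
    refine List.flatMap_injective_of_header (fun x => x = .one) _ ?_ ?_
    · intro i j h
      simpa using congrArg List.length h
    · exact fun j => ⟨.sep, _, rfl, by simp, fun y hy => List.eq_of_mem_replicate hy⟩
  intro u v h
  rcases u with ⟨_ | _, i⟩ | l | l <;> rcases v with ⟨_ | _, j⟩ | m | m <;>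
    simp only [CircuitNode.code, List.cons.injEq, reduceCtorEq, false_and, true_and] at h
  · simpa using congrArg List.length h
  · simpa using congrArg List.length h
  · exact congrArg _ (key h)
  · exact congrArg _ (key h)

theorem BoolCircuit.code_injective : Function.Injective BoolCircuit.code := by
  intro C D h
  have : C.nodes = D.nodes := by
    refine List.flatMap_injective_of_header (fun x => x = .one ∨ x = .sep) _
      CircuitNode.code_injective ?_ h
    intro v
    rcases v with ⟨_ | _, i⟩ | l | l
    · exact ⟨.neg, _, rfl, by simp, fun y hy => Or.inl (List.eq_of_mem_replicate hy)⟩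
    · exact ⟨.pos, _, rfl, by simp, fun y hy => Or.inl (List.eq_of_mem_replicate hy)⟩
    · refine ⟨.and, _, rfl, by simp, fun y hy => ?_⟩
      simp only [List.mem_flatMap, List.mem_cons, List.mem_replicate] at hy
      tauto
    · refine ⟨.or, _, rfl, by simp, fun y hy => ?_⟩
      simp only [List.mem_flatMap, List.mem_cons, List.mem_replicate] at hy
      tauto
  cases C; cases D; cases this; rfl

end CircuitCode

/-- Weighted Boolean Circuit Satisfiability, parameterized by the weight `k`. -/
def weightedCircuitSat : ParamProblem where
  Symbol := CircuitSymbol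
  Input := BoolCircuit
  code := BoolCircuit.code
  code_injective := BoolCircuit.code_injective
  Yes := BoolCircuit.WeightedSat

/-- The class W[P]: the parameterized problems that are fpt-reducible to the weighted satisfiability
problem for Boolean circuits. -/
def classWP : Set ParamProblem := {P | P.FPTReducible weightedCircuitSat}

/-! ## Colored Path -/

/-- `G` can be drawn in the plane: distinct vertices are distinct points, each edge is a simple arc
between its two ends, and the interior of an arc meets no vertex and no other arc. -/
def SimpleGraph.IsPlanar {V : Type*} (G : SimpleGraph V) : Prop :=
  ∃ (pos : V → ℝ × ℝ) (arc : G.edgeSet → C(unitInterval, ℝ × ℝ)),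
    Function.Injective pos ∧
    (∀ e, Function.Injective (arc e)) ∧
    (∀ e, s(arc e 0, arc e 1) = (e : Sym2 V).map pos) ∧
    (∀ e, ∀ x ∈ Set.Ioo (0 : unitInterval) 1, arc e x ∉ Set.range pos) ∧
    (∀ e e', e ≠ e' → ∀ x ∈ Set.Ioo (0 : unitInterval) 1, ∀ y ∈ Set.Ioo (0 : unitInterval) 1,
      arc e x ≠ arc e' y)

/-- An input of Colored Path: a planar graph on `n` vertices, `m` colors, a set of colors on each
vertex, and two designated vertices. -/
structure ColoredGraph where
  n : ℕ
  m : ℕ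
  G : SimpleGraph (Fin n)
  planar : G.IsPlanar
  χ : Fin n → Finset (Fin m)
  s : Fin n
  t : Fin n

namespace ColoredGraph

/-- There is an `s`-`t` path on whose vertices at most `k` colors appear. -/
def HasValidPath (I : ColoredGraph) (k : ℕ) : Prop :=
  ∃ p : I.G.Walk I.s I.t, p.IsPath ∧ (p.support.toFinset.biUnion I.χ).card ≤ k

/-- A number in unary, followed by the separator `none`. -/
def unary (a : ℕ) : List (Option Bool) := List.replicate a (some true) ++ [none]

/-- The 0/1-vector of a predicate on `Fin a`, followed by the separator `none`. -/
noncomputable def bits {a : ℕ} (p : Fin a → Prop) : List (Option Bool) :=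
  open Classical in (List.ofFn fun i => some (decide (p i))) ++ [none]

/-- The numbers `n` and `m`, the rows of the adjacency matrix, the 0/1-vectors of the color sets,
and the vertices `s` and `t`. -/
noncomputable def code (I : ColoredGraph) : List (Option Bool) :=
  unary I.n ++ unary I.m ++
    ((List.finRange I.n).flatMap fun u => bits fun v => I.G.Adj u v) ++
    ((List.finRange I.n).flatMap fun u => bits fun c => c ∈ I.χ u) ++
    unary I.s ++ unary I.t

theorem unary_append_inj {a b : ℕ} {l l' : List (Option Bool)}
    (h : unary a ++ l = unary b ++ l') : a = b ∧ l = l' := by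
  simp only [unary, List.append_assoc] at h
  obtain ⟨h1, h2⟩ := List.append_inj_of_all (fun x => x ≠ none)
    (by simp +contextual) (by simp +contextual) (by simp) (by simp) h
  exact ⟨by simpa using congrArg List.length h1, by simpa using h2⟩

theorem bits_length {a : ℕ} (p : Fin a → Prop) : (bits p).length = a + 1 := by
  simp [bits]

theorem bits_inj {a : ℕ} {p q : Fin a → Prop} (h : bits p = bits q) (i : Fin a) : p i ↔ q i := by
  classical
  have h := List.ofFn_injective (List.append_cancel_right h)
  simpa using congrFun h i

theorem flatMap_bits_append_inj {a b : ℕ} {p q : Fin b → Fin a → Prop} (L : List (Fin b))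
    {l l' : List (Option Bool)}
    (h : (L.flatMap fun u => bits (p u)) ++ l = (L.flatMap fun u => bits (q u)) ++ l') :
    (∀ u ∈ L, ∀ i, p u i ↔ q u i) ∧ l = l' := by
  induction L with
  | nil => exact ⟨by simp, by simpa using h⟩
  | cons u L ih =>
    simp only [List.flatMap_cons, List.append_assoc] at h
    obtain ⟨h1, h2⟩ := List.append_inj h (by simp [bits_length])
    obtain ⟨h3, h4⟩ := ih h2
    refine ⟨fun v hv => ?_, h4⟩
    rcases List.mem_cons.1 hv with rfl | hv
    · exact bits_inj h1
    · exact h3 v hv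

theorem code_injective : Function.Injective code := by
  rintro ⟨n, m, G, hG, χ, s, t⟩ ⟨n', m', G', hG', χ', s', t'⟩ h
  simp only [code, List.append_assoc] at h
  obtain ⟨rfl, h⟩ := unary_append_inj h
  obtain ⟨rfl, h⟩ := unary_append_inj h
  obtain ⟨h1, h⟩ := flatMap_bits_append_inj _ h
  obtain ⟨h2, h⟩ := flatMap_bits_append_inj _ h
  obtain ⟨h3, h⟩ := unary_append_inj h
  obtain ⟨h4, -⟩ := unary_append_inj (l := []) (l' := []) (by simpa using h)
  obtain rfl := Fin.ext h3
  obtain rfl := Fin.ext h4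
  obtain rfl : G = G' := by
    ext u v; exact h1 u (List.mem_finRange u) v
  obtain rfl : χ = χ' := by
    funext u; ext c; exact h2 u (List.mem_finRange u) c
  rfl

end ColoredGraph

/-- Colored Path, parameterized by the number `k` of colors. -/
noncomputable def coloredPath : ParamProblem where
  Symbol := Option Bool
  Input := ColoredGraph
  code := ColoredGraph.code
  code_injective := ColoredGraph.code_injective
  Yes := ColoredGraph.HasValidPath

/-!
The reduction maps an instance `G`, `k` of Colored Path to a circuit with parameter `k + 1`. The
circuit has a variable `0`, a variable `1 + c` for each color `c`, and `k` slack variables, by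
which "at most `k` colors" becomes an exact weight. Its first layer has a node for each vertex,
which is the literal of the variable `0` for the source and its negation for the other vertices.
Each of `n` rounds adds an OR-gate for each vertex, over the nodes of the vertex itself and of its
neighbours, and then an AND-gate for each vertex, over its OR-gate and the variables of its colors.
If the variable `0` is true, a vertex other than the source is thus reached after `l` rounds only
along a walk all of whose vertices, except for the source perhaps, have true colors only. The
output requires that the variable `0` is true and that the source and the target are reached after
`n` rounds; the former condition makes the remaining weight `k`, and the one on the source tests
its colors. Since a path has at most `n` vertices, `n` rounds are enough
(`ColoredPath.hasValidPath_iff`).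

The circuit is computed by a machine with a stack for each of a few unary counters. The machine is
given by a program in a small structured language, whose only control structure is a loop that pops
a stack. `StackProg.compile` translates such programs to machine code, and
`StackProg.Run.iterate_step` shows that the machine simulates the program without loss of time, so
that all that remains is to run the program (`ColoredPath.runs_program`). Both layers of a round
are written by one subprogram, which reads a 0/1-matrix row by row: the adjacency matrix for the
OR-gates, the color sets for the AND-gates.
-/

/-! ### A structured language for stack machines -/

/-- Programs acting on finitely many stacks, the stack `a` holding symbols from `Γ a`.
`loop a ends body` repeatedly pops a symbol from `a`; it ends when `a` is empty or the popped symbol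
satisfies `ends` (that symbol is then consumed), and otherwise runs the body chosen by that
symbol. -/
inductive StackProg {K : Type} (Γ : K → Type) : Type
  | skip : StackProg Γ
  | push (a : K) (x : Γ a) : StackProg Γ
  | seq (p q : StackProg Γ) : StackProg Γ
  | loop (a : K) (ends : Γ a → Bool) (body : Γ a → StackProg Γ) : StackProg Γ

namespace StackProg

variable {K : Type} {Γ : K → Type}

infixr:67 " ;; " => StackProg.seq

/-- `Run p S t S'`: started with the stacks `S`, the program `p` ends with the stacks `S'` after at
most `t` steps. -/
inductive Run [DecidableEq K] :
    StackProg Γ → (∀ a, List (Γ a)) → ℕ → (∀ a, List (Γ a)) → Prop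
  | skip {S} : Run skip S 1 S
  | push {a x S} : Run (push a x) S 1 (Function.update S a (x :: S a))
  | seq {p q S t S' t' S''} : Run p S t S' → Run q S' t' S'' → Run (seq p q) S (t + t') S''
  | loop_nil {a ends body S} : S a = [] → Run (loop a ends body) S 1 S
  | loop_ends {a ends body S x l} : S a = x :: l → ends x = true →
      Run (loop a ends body) S 1 (Function.update S a l)
  | loop_step {a ends body S x l t S' t' S''} : S a = x :: l → ends x = false →
      Run (body x) (Function.update S a l) t S' → Run (loop a ends body) S' t' S'' →
      Run (loop a ends body) S (1 + t + t') S''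
  | mono {p S t t' S'} : Run p S t S' → t ≤ t' → Run p S t' S'

/-- A program pushes at most one symbol per step. -/
theorem Run.length_le [DecidableEq K] {p : StackProg Γ} {S S' : ∀ a, List (Γ a)} {t : ℕ}
    (h : Run p S t S') (a : K) : (S' a).length ≤ (S a).length + t := by
  have key : ∀ (S : ∀ a, List (Γ a)) b (l : List (Γ b)) d, l.length ≤ (S b).length + d →
      (Function.update S b l a).length ≤ (S a).length + d := by
    intro S b l d h
    by_cases e : a = b
    · subst e; simpa using h
    · simp [e]
  induction h with
  | skip => simp
  | @push b x S => exact key S b _ 1 (by simp)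
  | seq _ _ hp hq => omega
  | loop_nil => simp
  | @loop_ends b ends body S x l h _ => exact key S b l 1 (by simp [h]; omega)
  | @loop_step b ends body S x l t S' t' S'' h _ _ _ hb hl =>
    have := key S b l 0 (by simp [h])
    omega
  | mono _ ht h => omega

/-- The rule for loops: the loop pops the symbols of `l` one after the other, then meets the bottom
of the stack or a stopping symbol. Here `f i` describes the stacks after `i` rounds. -/
theorem Run.loop_list [DecidableEq K] {a : K} {ends : Γ a → Bool} {body : Γ a → StackProg Γ} {T : ℕ}
    (l r : List (Γ a)) (f : ℕ → ∀ a, List (Γ a)) (hf : ∀ i ≤ l.length, f i a = l.drop i ++ r)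
    (hl : ∀ x ∈ l, ends x = false) (hr : ∀ x ∈ r.head?, ends x = true)
    (hbody : ∀ i (h : i < l.length),
      Run (body l[i]) (Function.update (f i) a (l.drop (i + 1) ++ r)) T (f (i + 1))) :
    Run (loop a ends body) (f 0) ((T + 1) * l.length + 1)
      (Function.update (f l.length) a r.tail) := by
  suffices H : ∀ j i, i + j = l.length → Run (loop a ends body) (f i) ((T + 1) * j + 1)
      (Function.update (f l.length) a r.tail) from H _ 0 (by simp)
  intro j
  induction j with
  | zero =>
    rintro i rfl
    have h := hf _ le_rfl
    cases r with
    | nil =>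
      rw [show Function.update (f (l.length)) a ([] : List (Γ a)).tail = f l.length from by
        conv_rhs => rw [← Function.update_eq_self a (f l.length)]
        simp [h]]
      simpa using Run.loop_nil (by simpa using h)
    | cons y r =>
      simpa using Run.loop_ends (by simpa using h) (hr y (by simp))
  | succ j ih =>
    intro i hi
    have hi' : i < l.length := by omega
    refine (Run.loop_step (x := l[i]) (l := l.drop (i + 1) ++ r) ?_ (hl _ (List.getElem_mem _))
      (hbody i hi') (ih (i + 1) (by omega))).mono (by ring_nf; omega)
    rw [hf i hi'.le, List.drop_eq_getElem_cons hi', List.cons_append]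

/-- The control points of a program. -/
def Label : StackProg Γ → Type
  | skip => Unit
  | push _ _ => Unit
  | seq p q => p.Label ⊕ q.Label
  | loop _ _ body => Option (Σ x, (body x).Label)

instance finite_label [∀ a, Finite (Γ a)] (p : StackProg Γ) : Finite p.Label := by
  induction p with
  | skip => exact inferInstanceAs (Finite Unit)
  | push a x => exact inferInstanceAs (Finite Unit)
  | seq p q hp hq => exact inferInstanceAs (Finite (p.Label ⊕ q.Label))
  | loop a ends body h => exact inferInstanceAs (Finite (Option (Σ x, (body x).Label)))

/-- The control point at which a program starts. -/
def entry : (p : StackProg Γ) → p.Label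
  | skip => ()
  | push _ _ => ()
  | seq p _ => Sum.inl p.entry
  | loop _ _ _ => none

open Turing

variable [DecidableEq K]

/-- The machine code of a program, as a part of a machine with labels `Λ`, in which `emb` locates
the control points of the program and `exit` is what is to be done after it. For each stack, the
internal state of the machine records the last symbol that was popped from it. -/
def compile : (p : StackProg Γ) → {Λ : Type} → (p.Label → Λ) →
    TM2.Stmt Γ Λ (∀ a, Option (Γ a)) → p.Label → TM2.Stmt Γ Λ (∀ a, Option (Γ a))
  | skip, _, _, exit, _ => exit
  | push a x, _, _, exit, _ => .push a (fun _ => x) exit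
  | seq p q, _, emb, _, .inl l =>
      p.compile (fun l => emb (.inl l)) (.goto fun _ => emb (.inr q.entry)) l
  | seq _ q, _, emb, exit, .inr l => q.compile (fun l => emb (.inr l)) exit l
  | loop a ends body, _, emb, exit, none =>
      .pop a (fun v x => Function.update v a x)
        (.branch (fun v => (v a).elim true ends) exit
          (.goto fun v => emb ((v a).map fun x => ⟨x, (body x).entry⟩)))
  | loop _ _ body, _, emb, _, some ⟨x, l⟩ =>
      (body x).compile (fun l => emb (some ⟨x, l⟩)) (.goto fun _ => emb none) l

/-- Machine code follows the runs of its program. -/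
theorem Run.iterate_step {p : StackProg Γ} {S S' : ∀ a, List (Γ a)} {t : ℕ} (h : Run p S t S')
    {Λ : Type} (M : Λ → TM2.Stmt Γ Λ (∀ a, Option (Γ a))) (emb : p.Label → Λ)
    (exit : TM2.Stmt Γ Λ (∀ a, Option (Γ a))) (hM : ∀ l, M (emb l) = p.compile emb exit l)
    (v : ∀ a, Option (Γ a)) :
    ∃ t' ≤ t, ∃ v', (flip bind (TM2.step M))^[t'] (some ⟨some (emb p.entry), v, S⟩) =
      some (TM2.stepAux exit v' S') := by
  induction h generalizing Λ v with
  | @skip S =>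
    exact ⟨1, le_rfl, v, by simp [flip, TM2.step, hM, compile]⟩
  | @push a x S =>
    exact ⟨1, le_rfl, v, by simp [flip, TM2.step, hM, compile, TM2.stepAux]⟩
  | @seq p q S t S' t' S'' _ _ hp hq =>
    -- The code of `p` is left by a jump to the entry of `q`.
    obtain ⟨u, hu, w, e⟩ := hp M (fun l => emb (.inl l)) (.goto fun _ => emb (.inr q.entry))
      (fun l => hM (.inl l)) v
    obtain ⟨u', hu', w', e'⟩ := hq M (fun l => emb (.inr l)) exit (fun l => hM (.inr l)) w
    refine ⟨u' + u, by omega, w', ?_⟩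
    rw [Function.iterate_add_apply]
    exact (congrArg _ e).trans e'
  | @loop_nil a ends body S h =>
    refine ⟨1, le_rfl, Function.update v a none, ?_⟩
    have := hM none
    simp [flip, TM2.step, entry, this, compile, TM2.stepAux, h]
    rw [← h, Function.update_eq_self]
  | @loop_ends a ends body S x l h hx =>
    refine ⟨1, le_rfl, Function.update v a (some x), ?_⟩
    have := hM none
    simp [flip, TM2.step, entry, this, compile, TM2.stepAux, h, hx]
  | @loop_step a ends body S x l t S' t' S'' h hx _ _ hb hl =>
    obtain ⟨u, hu, w, e⟩ := hb M (fun l => emb (some ⟨x, l⟩)) (.goto fun _ => emb none)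
      (fun l => hM (some ⟨x, l⟩)) (Function.update v a (some x))
    obtain ⟨u', hu', w', e'⟩ := hl M emb exit hM w
    refine ⟨u' + (u + 1), by omega, w', ?_⟩
    rw [Function.iterate_add_apply, Function.iterate_add_apply, ← e']
    refine congrArg _ ((congrArg _ ?_).trans e)
    have := hM none
    simp [flip, TM2.step, entry, this, compile, TM2.stepAux, h, hx]
  | mono _ ht h =>
    obtain ⟨u, hu, w, e⟩ := h M emb exit hM v
    exact ⟨u, hu.trans ht, w, e⟩

/-- The machine that runs a program, with the input on the stack `k₀` and the output on `k₁`, and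
that finally clears its internal state. -/
noncomputable def machine [Fintype K] [∀ a, Fintype (Γ a)] (p : StackProg Γ) (k₀ k₁ : K) :
    FinTM2 :=
  { K := K
    k₀ := k₀
    k₁ := k₁
    Γ := Γ
    Λ := p.Label
    main := p.entry
    ΛFin := Fintype.ofFinite _
    σ := ∀ a, Option (Γ a)
    initialState := fun _ => none
    m := p.compile id (.load (fun _ _ => none) .halt) }

/-- The stacks of `initList` and `haltList`. -/
theorem stacks_eq_update {k₀ : K} (l : List (Γ k₀)) :
    (fun k => dite (k = k₀) (fun h => by rw [h]; exact l) fun _ => []) =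
      Function.update (fun k => ([] : List (Γ k))) k₀ l := by
  funext k
  by_cases hk : k = k₀
  · subst hk; simp
  · simp [hk]

/-- A run from the input stack alone to the output stack alone is a computation of the machine. -/
theorem Run.outputsInTime [Fintype K] [∀ a, Fintype (Γ a)] {p : StackProg Γ} {k₀ k₁ : K}
    {l₀ : List (Γ k₀)} {l₁ : List (Γ k₁)} {t : ℕ}
    (h : Run p (Function.update (fun _ => []) k₀ l₀) t (Function.update (fun _ => []) k₁ l₁)) :
    Nonempty (TM2OutputsInTime (p.machine k₀ k₁) l₀ (some l₁) t) := by
  obtain ⟨u, hu, w, e⟩ := h.iterate_step (p.machine k₀ k₁).m id _ (fun _ => rfl) fun _ => none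
  have h₀ : initList (p.machine k₀ k₁) l₀ =
      (⟨some p.entry, fun _ => none, Function.update (fun _ => []) k₀ l₀⟩ : TM2.Cfg Γ p.Label _) :=
    congrArg (TM2.Cfg.mk (some p.entry) fun _ => none) (stacks_eq_update l₀)
  have h₁ : haltList (p.machine k₀ k₁) l₁ =
      (⟨none, fun _ => none, Function.update (fun _ => []) k₁ l₁⟩ : TM2.Cfg Γ p.Label _) :=
    congrArg (TM2.Cfg.mk none fun _ => none) (stacks_eq_update l₁)
  refine ⟨⟨⟨u, ?_⟩, hu⟩⟩
  refine (congrArg (fun c => (flip bind (p.machine k₀ k₁).step)^[u] (some c)) h₀).trans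
    (e.trans (congrArg some h₁.symm))

end StackProg

/-! ### Memory and elementary programs -/

namespace ColoredPath

/-- The counters of the reduction: the numbers of slack variables, of vertices whose row is still
to be processed, of processed rows, of vertices still without a source literal, and of remaining
rounds; the index of the first node of the current layer; the constant `1`; the column in the
current row; the source and the target; and a scratch counter. -/
inductive Counter
  | slack | todo | done | rest | rounds | base | one | col | src | tgt | tmp
  deriving DecidableEq

instance : Fintype Counter :=
  ⟨{.slack, .todo, .done, .rest, .rounds, .base, .one, .col, .src, .tgt, .tmp},
    fun x => by cases x <;> simp⟩

/-- The stacks of the reduction: the input, the part of the input that has been read, the reversed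
output, the output, and a stack in unary for each counter. -/
inductive Stack
  | inp | save | rev | out | cnt (c : Counter)
  deriving DecidableEq, Fintype

/-- The alphabets of the stacks. -/
@[reducible] def Stack.Sym : Stack → Type
  | inp => Option (Option Bool)
  | save => Option (Option Bool)
  | rev => Option CircuitSymbol
  | out => Option CircuitSymbol
  | cnt _ => Unit

instance (a : Stack) : Fintype a.Sym :=
  match a with
  | .inp => inferInstanceAs (Fintype (Option (Option Bool)))
  | .save => inferInstanceAs (Fintype (Option (Option Bool)))
  | .rev => inferInstanceAs (Fintype (Option CircuitSymbol))
  | .out => inferInstanceAs (Fintype (Option CircuitSymbol))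
  | .cnt _ => inferInstanceAs (Fintype Unit)

/-- Programs acting on these stacks. -/
abbrev Prog := StackProg Stack.Sym

/-- The contents of the stacks, with counters as numbers. -/
@[ext] structure Mem where
  inp : List (Option (Option Bool))
  save : List (Option (Option Bool))
  rev : List (Option CircuitSymbol)
  out : List (Option CircuitSymbol)
  ctr : Counter → ℕ

namespace Mem

/-- The stacks, with counters in unary. -/
def stk (m : Mem) : ∀ a : Stack, List a.Sym
  | .inp => m.inp
  | .save => m.save
  | .rev => m.rev
  | .out => m.out
  | .cnt c => List.replicate (m.ctr c) ()

/-- Set the counter `c` to `n`. -/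
def set (m : Mem) (c : Counter) (n : ℕ) : Mem := { m with ctr := Function.update m.ctr c n }

/-- Append the word `w` to the reversed output. -/
def write (m : Mem) (w : List CircuitSymbol) : Mem :=
  { m with rev := (w.map some).reverse ++ m.rev }

theorem stk_inp (m : Mem) (l : List (Option (Option Bool))) :
    Function.update m.stk .inp l = { m with inp := l }.stk := by
  funext a; cases a <;> rfl

theorem stk_save (m : Mem) (l : List (Option (Option Bool))) :
    Function.update m.stk .save l = { m with save := l }.stk := by
  funext a; cases a <;> rfl

theorem stk_rev (m : Mem) (l : List (Option CircuitSymbol)) :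
    Function.update m.stk .rev l = { m with rev := l }.stk := by
  funext a; cases a <;> rfl

theorem stk_out (m : Mem) (l : List (Option CircuitSymbol)) :
    Function.update m.stk .out l = { m with out := l }.stk := by
  funext a; cases a <;> rfl

theorem stk_cnt (m : Mem) (c : Counter) (n : ℕ) :
    Function.update m.stk (.cnt c) (List.replicate n ()) = (m.set c n).stk := by
  funext a
  by_cases h : a = .cnt c
  · subst h; simp [stk, set]
  · cases a
    case cnt d =>
      have : d ≠ c := fun e => h (e ▸ rfl)
      simp [stk, set, this]
    all_goals rfl

end Mem

/-- `Runs p m t m'`: the program `p` leads from the memory `m` to the memory `m'` in at most `t`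
steps. -/
def Runs (p : Prog) (m : Mem) (t : ℕ) (m' : Mem) : Prop := p.Run m.stk t m'.stk

theorem Runs.of_eq {p : Prog} {m m' m'' : Mem} {t t' : ℕ} (h : Runs p m t m') (e : m' = m'')
    (ht : t ≤ t') : Runs p m t' m'' := e ▸ h.mono ht

theorem Runs.of_start {p : Prog} {m m' m'' : Mem} {t : ℕ} (e : m = m') (h : Runs p m' t m'') :
    Runs p m t m'' := e ▸ h

theorem Runs.seq {p q : Prog} {m m' m'' : Mem} {t t' : ℕ} (h : Runs p m t m')
    (h' : Runs q m' t' m'') : Runs (p ;; q) m (t + t') m'' := StackProg.Run.seq h h'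

theorem Runs.append {p q : Prog} {m m₁ m₁' m₂ : Mem} {t t' : ℕ} (h : Runs p m t m₁)
    (h' : Runs q m₁' t' m₂) (e : m₁ = m₁') : Runs (p ;; q) m (t + t') m₂ := (e ▸ h).seq h'

/-- Write the symbol `x`. -/
def put (x : Option CircuitSymbol) : Prog := .push .rev x

/-- Save the symbol `x` of the input. -/
def keep (x : Option (Option Bool)) : Prog := .push .save x

/-- Increment the counter `c`. -/
def inc (c : Counter) : Prog := .push (.cnt c) ()

/-- Count `c` down to `0`, running `p` each time. -/
def countdown (c : Counter) (p : Prog) : Prog := .loop (.cnt c) (fun _ => false) fun _ => p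

/-- Decrement `c`, unless it is `0`: the symbol that the loop pops ends it. -/
def dec (c : Counter) : Prog := .loop (.cnt c) (fun _ => true) fun _ => .skip

theorem runs_put (m : Mem) (x) : Runs (put x) m 1 { m with rev := x :: m.rev } := by
  have h := StackProg.Run.push (a := Stack.rev) (x := x) (S := m.stk)
  rw [Mem.stk_rev] at h
  exact h

theorem runs_put_some (m : Mem) (x) : Runs (put (some x)) m 1 (m.write [x]) := runs_put m _

theorem runs_keep (m : Mem) (x) : Runs (keep x) m 1 { m with save := x :: m.save } := by
  have h := StackProg.Run.push (a := Stack.save) (x := x) (S := m.stk)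
  rw [Mem.stk_save] at h
  exact h

theorem runs_push_inp (m : Mem) (x) :
    Runs (.push .inp x) m 1 { m with inp := x :: m.inp } := by
  have h := StackProg.Run.push (a := Stack.inp) (x := x) (S := m.stk)
  rw [Mem.stk_inp] at h
  exact h

theorem runs_push_out (m : Mem) (x) :
    Runs (.push .out x) m 1 { m with out := x :: m.out } := by
  have h := StackProg.Run.push (a := Stack.out) (x := x) (S := m.stk)
  rw [Mem.stk_out] at h
  exact h

theorem runs_inc (m : Mem) (c) : Runs (inc c) m 1 (m.set c (m.ctr c + 1)) := by
  have h := StackProg.Run.push (a := Stack.cnt c) (x := ()) (S := m.stk)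
  have e : (() :: m.stk (.cnt c) : List Unit) = List.replicate (m.ctr c + 1) () := rfl
  rw [e, Mem.stk_cnt] at h
  exact h

theorem runs_dec (m : Mem) (c) : Runs (dec c) m 1 (m.set c (m.ctr c - 1)) := by
  unfold Runs
  rw [← Mem.stk_cnt]
  cases h : m.ctr c with
  | zero =>
    have h' : m.stk (.cnt c) = [] := by simp [Mem.stk, h]
    rw [show (List.replicate (0 - 1) () : List (Stack.cnt c).Sym) = m.stk (.cnt c) from h'.symm,
      Function.update_eq_self]
    exact StackProg.Run.loop_nil h'
  | succ n =>
    refine StackProg.Run.loop_ends (x := ()) ?_ rfl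
    rw [Mem.stk, h, List.replicate_succ]
    rfl

/-- The rule for `countdown`: `f i` is the memory after `i` rounds. -/
theorem runs_countdown {c : Counter} {p : Prog} {T : ℕ} (N : ℕ) (f : ℕ → Mem)
    (hf : ∀ i ≤ N, (f i).ctr c = N - i)
    (hp : ∀ i < N, Runs p ((f i).set c (N - (i + 1))) T (f (i + 1))) :
    Runs (countdown c p) (f 0) ((T + 1) * N + 1) (f N) := by
  have := StackProg.Run.loop_list (a := Stack.cnt c) (ends := fun _ => false) (body := fun _ => p)
    (T := T) (List.replicate N ()) [] (fun i => (f i).stk)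
    (fun i hi => by simp [Mem.stk, hf i (by simpa using hi)]) (by simp) (by simp)
    (fun i hi => by
      rw [List.length_replicate] at hi
      rw [List.append_nil, List.drop_replicate]
      rw [Mem.stk_cnt]
      exact hp i hi)
  rw [List.length_replicate] at this
  have h0 : (f N).stk (.cnt c) = [] := by simp [Mem.stk, hf N le_rfl]
  rwa [List.tail_nil, ← h0, Function.update_eq_self] at this

theorem runs_loop_inp {ends} {p : Option (Option Bool) → Prog} {T : ℕ}
    (l r : List (Option (Option Bool))) (f : ℕ → Mem)
    (hf : ∀ i ≤ l.length, (f i).inp = l.drop i ++ r)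
    (hl : ∀ x ∈ l, ends x = false) (hr : ∀ x ∈ r.head?, ends x = true)
    (hp : ∀ i (h : i < l.length),
      Runs (p l[i]) { f i with inp := l.drop (i + 1) ++ r } T (f (i + 1))) :
    Runs (.loop .inp ends p) (f 0) ((T + 1) * l.length + 1)
      { f l.length with inp := r.tail } := by
  have h := StackProg.Run.loop_list (a := Stack.inp) (body := p) (T := T) l r
    (fun i => (f i).stk) hf hl hr
    fun i hi => by rw [Mem.stk_inp]; exact hp i hi
  rw [Mem.stk_inp] at h
  exact h

theorem runs_loop_save {ends} {p : Option (Option Bool) → Prog} {T : ℕ}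
    (l r : List (Option (Option Bool))) (f : ℕ → Mem)
    (hf : ∀ i ≤ l.length, (f i).save = l.drop i ++ r)
    (hl : ∀ x ∈ l, ends x = false) (hr : ∀ x ∈ r.head?, ends x = true)
    (hp : ∀ i (h : i < l.length),
      Runs (p l[i]) { f i with save := l.drop (i + 1) ++ r } T (f (i + 1))) :
    Runs (.loop .save ends p) (f 0) ((T + 1) * l.length + 1)
      { f l.length with save := r.tail } := by
  have h := StackProg.Run.loop_list (a := Stack.save) (body := p) (T := T) l r
    (fun i => (f i).stk) hf hl hr
    fun i hi => by rw [Mem.stk_save]; exact hp i hi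
  rw [Mem.stk_save] at h
  exact h

theorem runs_loop_rev {p : Option CircuitSymbol → Prog} {T : ℕ}
    (l : List (Option CircuitSymbol)) (f : ℕ → Mem)
    (hf : ∀ i ≤ l.length, (f i).rev = l.drop i)
    (hp : ∀ i (h : i < l.length),
      Runs (p l[i]) { f i with rev := l.drop (i + 1) } T (f (i + 1))) :
    Runs (.loop .rev (fun _ => false) p) (f 0) ((T + 1) * l.length + 1)
      { f l.length with rev := [] } := by
  have h := StackProg.Run.loop_list (a := Stack.rev) (ends := fun _ => false) (body := p)
    (T := T) l [] (fun i => (f i).stk)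
    (fun i hi => by rw [List.append_nil]; exact hf i hi) (fun _ _ => rfl) (by simp)
    fun i hi => by rw [List.append_nil, Mem.stk_rev]; exact hp i hi
  rw [List.tail_nil, Mem.stk_rev] at h
  exact h

namespace Mem

@[simp] theorem write_inp (m : Mem) (w) : (m.write w).inp = m.inp := rfl
@[simp] theorem write_save (m : Mem) (w) : (m.write w).save = m.save := rfl
@[simp] theorem write_out (m : Mem) (w) : (m.write w).out = m.out := rfl
@[simp] theorem write_ctr (m : Mem) (w) : (m.write w).ctr = m.ctr := rfl
@[simp] theorem set_inp (m : Mem) (c n) : (m.set c n).inp = m.inp := rfl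
@[simp] theorem set_save (m : Mem) (c n) : (m.set c n).save = m.save := rfl
@[simp] theorem set_rev (m : Mem) (c n) : (m.set c n).rev = m.rev := rfl
@[simp] theorem set_out (m : Mem) (c n) : (m.set c n).out = m.out := rfl
@[simp] theorem set_ctr (m : Mem) (c n) : (m.set c n).ctr = Function.update m.ctr c n := rfl
@[simp] theorem write_write (m : Mem) (w w') : (m.write w).write w' = m.write (w ++ w') := by
  simp [write]
theorem set_eq_self {m : Mem} {c : Counter} {n : ℕ} (h : m.ctr c = n) : m.set c n = m := by
  subst h; simp [set]

end Mem

/-- Write the counter `c` in unary. The scratch counter serves to restore `c`. -/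
def emit (c : Counter) : Prog :=
  countdown c (inc .tmp ;; put (some .one)) ;; countdown .tmp (inc c)

theorem runs_emit (m : Mem) (c : Counter) (hc : c ≠ .tmp) (h : m.ctr .tmp = 0) :
    Runs (emit c) m (5 * m.ctr c + 2) (m.write (List.replicate (m.ctr c) .one)) := by
  have h1 := runs_countdown (c := c) (p := inc .tmp ;; put (some .one)) (T := 2) (m.ctr c)
    (fun i => ((m.set c (m.ctr c - i)).set .tmp i).write (List.replicate i .one))
    (fun i _ => by simp [hc]) (fun i hi => by
      refine ((runs_inc _ _).seq (runs_put_some _ _)).of_eq ?_ le_rfl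
      ext1
      case rev => simp [Mem.write, List.replicate_succ']
      case ctr =>
        funext d
        by_cases hd : d = .tmp <;> by_cases hd' : d = c <;> simp_all
      all_goals simp)
  have h2 := runs_countdown (c := .tmp) (p := inc c) (T := 1) (m.ctr c)
    (fun i => ((m.set c i).set .tmp (m.ctr c - i)).write (List.replicate (m.ctr c) .one))
    (fun i _ => by simp) (fun i hi => by
      refine (runs_inc _ _).of_eq ?_ le_rfl
      ext1 <;> simp [Mem.write]
      funext d
      by_cases hd : d = .tmp <;> by_cases hd' : d = c <;> simp_all)
  have e1 : ((m.set c (m.ctr c - 0)).set .tmp 0).write (List.replicate 0 .one) = m := by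
    rw [Nat.sub_zero, Mem.set_eq_self rfl, Mem.set_eq_self h]
    rfl
  have e2 : ((m.set c (m.ctr c)).set .tmp (m.ctr c - m.ctr c)).write
      (List.replicate (m.ctr c) .one) = m.write (List.replicate (m.ctr c) .one) := by
    rw [Mem.set_eq_self rfl, Nat.sub_self, Mem.set_eq_self h]
  rw [e1] at h1
  rw [e2] at h2
  rw [Nat.sub_self] at h1
  exact (h1.seq h2).of_eq rfl (by omega)

/-- Reset a counter to `0`. -/
def clear (c : Counter) : Prog := countdown c .skip

theorem runs_clear (m : Mem) (c : Counter) : Runs (clear c) m (2 * m.ctr c + 1) (m.set c 0) := by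
  have := runs_countdown (c := c) (p := .skip) (T := 1) (m.ctr c)
    (fun i => m.set c (m.ctr c - i)) (fun i _ => by simp) (fun i hi => by
      have : (m.set c (m.ctr c - i)).set c (m.ctr c - (i + 1)) = m.set c (m.ctr c - (i + 1)) := by
        simp [Mem.set]
      rw [this]; exact .skip)
  have e : m.set c (m.ctr c - 0) = m := by simp [Mem.set]
  rw [e, Nat.sub_self] at this
  exact this

/-- Write a reference to the node whose index is the sum of the two counters. -/
def ref (c d : Counter) : Prog := put (some .sep) ;; emit c ;; emit d

theorem runs_ref (m : Mem) (c d : Counter) (hc : c ≠ .tmp) (hd : d ≠ .tmp) (h : m.ctr .tmp = 0) :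
    Runs (ref c d) m (5 * (m.ctr c + m.ctr d) + 5)
      (m.write (.sep :: List.replicate (m.ctr c + m.ctr d) .one)) := by
  refine ((runs_put_some m .sep).seq ((runs_emit _ c hc (by simpa)).seq
    (runs_emit _ d hd (by simpa)))).of_eq ?_ ?_
  · simp
  · simp; omega

/-! ### The nodes of the circuit -/

/-- `n` gates, numbered from `B + n` on if the previous layer starts at `B`. The gate of `v` reads
the node `B + v` of the previous layer, and the nodes `d + u` for all `u < q` with `p v u`. -/
def layer (gate : List ℕ → CircuitNode) (n q : ℕ) (p : ℕ → ℕ → Bool) (d B : ℕ) :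
    List CircuitNode :=
  (List.range n).map fun v => gate ((B + v) :: ((List.range q).filter (p v)).map (d + ·))

/-- An instance of Colored Path in terms of natural numbers: `n` vertices, `m` colors, adjacency,
which colors a vertex has, source and target. -/
structure Data where
  n : ℕ
  m : ℕ
  adj : ℕ → ℕ → Bool
  col : ℕ → ℕ → Bool
  s : ℕ
  t : ℕ

namespace Data

variable (I : Data) (k : ℕ)

/-- The index of the first node of the last layer after `l` rounds. The nodes before the first layer
are the `1 + m + k` variables. -/
def start (l : ℕ) : ℕ := 1 + I.m + k + 2 * I.n * l

/-- The layer of OR-gates and the layer of AND-gates of a round, if the layer before them starts at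
`B`. -/
def roundNodes (B : ℕ) : List CircuitNode :=
  layer .or I.n I.n I.adj B B ++ layer .and I.n I.m I.col 1 (B + I.n)

/-- The nodes after `l` rounds: the variables, the first layer, and the layers of the rounds. -/
def stage : ℕ → List CircuitNode
  | 0 => (List.range (1 + I.m + k)).map (.lit true) ++
      (List.range I.n).map fun v => .lit (decide (v = I.s)) 0
  | l + 1 => stage l ++ I.roundNodes (I.start k l)

/-- The nodes of the circuit: `n` rounds, followed by the two gates of the output. The first of the
two tests the source, the second one the target. A single gate for both would have a repeated
in-neighbour if they are equal. -/
def nodes : List CircuitNode :=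
  I.stage k I.n ++ [.and [0, I.start k I.n + I.s],
    .and [I.start k I.n + I.n, I.start k I.n + I.t]]

end Data

/-! ### Writing the layers of the circuit -/

/-- The code of a list of references to nodes. -/
def refs (l : List ℕ) : List CircuitSymbol :=
  l.flatMap fun j => .sep :: List.replicate j .one

@[simp] theorem refs_append (l l' : List ℕ) : refs (l ++ l') = refs l ++ refs l' :=
  List.flatMap_append

@[simp] theorem refs_nil : refs [] = [] := rfl

@[simp] theorem refs_cons (j : ℕ) (l : List ℕ) :
    refs (j :: l) = .sep :: List.replicate j .one ++ refs l := rfl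

/-- The 0/1-vector of `p` on `0, …, q - 1`. -/
def rowBits (q : ℕ) (p : ℕ → Bool) : List (Option (Option Bool)) :=
  (List.range q).map fun j => some (some (p j))

/-- The rows of a matrix, each followed by a separator. -/
def matrix (n q : ℕ) (p : ℕ → ℕ → Bool) : List (Option (Option Bool)) :=
  (List.range n).flatMap fun v => rowBits q (p v) ++ [some none]

/-- Process one entry of a row: if it is `1`, refer to the node whose index is the sum of `d` and of
the column. -/
def rowEntry (d : Counter) : Option (Option Bool) → Prog
  | some (some true) => ref d .col ;; inc .col
  | _ => inc .col

/-- Whether a symbol of the input is `0` or `1`. -/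
def isBit (x : Option (Option Bool)) : Bool := x != none && x != some none

/-- Write the gate for the next row of a matrix: a reference to the node of the previous layer, then
one for each entry `1` of the row. The row is saved. -/
def row (g : CircuitSymbol) (d : Counter) : Prog :=
  put (some g) ;; ref .base .done ;;
    .loop .inp (fun x => !isBit x) (fun x => keep x ;; rowEntry d x) ;;
      keep (some none) ;; clear .col

theorem runs_row (g : CircuitSymbol) (d : Counter) (hd : d = .base ∨ d = .one) (q : ℕ)
    (p : ℕ → Bool) (m : Mem) (r : List (Option (Option Bool))) (D : ℕ)
    (htmp : m.ctr .tmp = 0) (hcol : m.ctr .col = 0) (hinp : m.inp = rowBits q p ++ some none :: r)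
    (hb : m.ctr .base ≤ D) (hdone : m.ctr .done ≤ D) (hdD : m.ctr d ≤ D) (hq : q ≤ D) :
    Runs (row g d) m (10 * D ^ 2 + 20 * D + 11)
      (Mem.write { m with inp := r, save := some none :: ((rowBits q p).reverse ++ m.save) }
        (g :: refs ((m.ctr .base + m.ctr .done) ::
          ((List.range q).filter p).map (m.ctr d + ·)))) := by
  have hd1 : d ≠ .tmp := by rcases hd with rfl | rfl <;> simp
  have hd2 : d ≠ .col := by rcases hd with rfl | rfl <;> simp
  have hlen : (rowBits q p).length = q := by simp [rowBits]
  have h1 := runs_put_some m g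
  have h2 := runs_ref (m.write [g]) .base .done (by simp) (by simp) htmp
  set w := g :: refs [m.ctr .base + m.ctr .done]
  have h3 := runs_loop_inp (ends := fun x => !isBit x) (p := fun x => keep x ;; rowEntry d x)
    (T := 10 * D + 7) (rowBits q p) (some none :: r)
    (fun i => ((({ m with
        inp := (rowBits q p).drop i ++ some none :: r
        save := (rowBits i p).reverse ++ m.save } : Mem).set .col i).write w).write
          (refs (((List.range i).filter p).map (m.ctr d + ·))))
    (fun i _ => rfl) (by simp [rowBits, isBit]) (by simp [isBit]) (fun i hi => by
      rw [hlen] at hi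
      have hx : (rowBits q p)[i]'(by rwa [hlen]) = some (some (p i)) := by simp [rowBits]
      rw [hx]
      refine ((runs_keep _ _).seq (t' := 10 * D + 6) ?_).of_eq rfl (by omega)
      cases hp : p i with
      | false =>
        refine (runs_inc _ _).of_eq ?_ (by omega)
        simp [Mem.write, Mem.set, rowBits, List.range_succ, hp]
      | true =>
        refine ((runs_ref _ d .col hd1 (by simp) (by simpa using htmp)).seq
          (runs_inc _ _)).of_eq ?_ ?_
        · simp [Mem.write, Mem.set, rowBits, List.range_succ, hp, hd2]
        · simp [hd2]; omega)
  refine (h1.seq (h2.append (h3.seq ((runs_keep _ (some none)).seq (runs_clear _ .col)))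
    ?_)).of_eq ?_ ?_
  · rw [Mem.write_write]
    simp [Mem.write, Mem.set, w, hinp, rowBits, hcol]
  · simp [Mem.write, Mem.set, w, hlen, hcol]
  · simp [hlen]
    nlinarith

/-- Write a layer, consuming a matrix of the input. -/
def layerProg (g : CircuitSymbol) (d : Counter) : Prog :=
  countdown .todo (row g d ;; inc .done) ;; countdown .done (inc .todo ;; inc .base)

theorem runs_layerProg {g : CircuitSymbol} {gate : List ℕ → CircuitNode}
    (hg : ∀ l, (gate l).code = g :: refs l) (d : Counter) (hd : d = .base ∨ d = .one) (n q : ℕ)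
    (p : ℕ → ℕ → Bool) (m : Mem) (r : List (Option (Option Bool))) (D : ℕ)
    (htmp : m.ctr .tmp = 0) (hcol : m.ctr .col = 0) (hdone : m.ctr .done = 0)
    (htodo : m.ctr .todo = n) (hinp : m.inp = matrix n q p ++ r)
    (hb : m.ctr .base ≤ D) (hn : n ≤ D) (hdD : m.ctr d ≤ D) (hq : q ≤ D) :
    Runs (layerProg g d) m (D * (10 * D ^ 2 + 20 * D + 16) + 2)
      ((({ m with inp := r, save := (matrix n q p).reverse ++ m.save } : Mem).set .base
        (m.ctr .base + n)).write
          ((layer gate n q p (m.ctr d) (m.ctr .base)).flatMap CircuitNode.code)) := by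
  have hd1 : d ≠ .todo := by rcases hd with rfl | rfl <;> simp
  have hd2 : d ≠ .done := by rcases hd with rfl | rfl <;> simp
  have h1 := runs_countdown (c := .todo) (p := row g d ;; inc .done)
    (T := 10 * D ^ 2 + 20 * D + 12) n
    (fun i => ((({ m with
        inp := (((List.range n).drop i).flatMap fun v => rowBits q (p v) ++ [some none]) ++ r
        save := (matrix i q p).reverse ++ m.save } : Mem).set .todo (n - i)).set .done i).write
          ((layer gate i q p (m.ctr d) (m.ctr .base)).flatMap CircuitNode.code))
    (fun i _ => by simp) (fun i hi => by
      have hdrop : (List.range n).drop i = i :: (List.range n).drop (i + 1) := by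
        rw [List.drop_eq_getElem_cons (by simpa using hi), List.getElem_range]
      refine ((runs_row g d hd q (p i) _
        ((((List.range n).drop (i + 1)).flatMap fun v => rowBits q (p v) ++ [some none]) ++ r) D
        (by simpa using htmp) (by simpa using hcol) ?_ (by simpa using hb)
        (by simpa using hi.le.trans hn) (by simpa [hd1, hd2] using hdD) hq).seq
          (runs_inc _ _)).of_eq ?_ le_rfl
      · simp [hdrop]
      · ext1
        case ctr =>
          funext c
          by_cases h : c = .todo <;> by_cases h' : c = .done <;> simp_all
        case rev => simp [Mem.write, layer, List.range_succ, hg, hd1, hd2]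
        all_goals simp [matrix, List.range_succ])
  set m₁ : Mem := { m with inp := r, save := (matrix n q p).reverse ++ m.save }
  have h2 := runs_countdown (c := .done) (p := inc .todo ;; inc .base) (T := 2) n
    (fun i => (((m₁.set .base (m.ctr .base + i)).set .todo i).set .done (n - i)).write
      ((layer gate n q p (m.ctr d) (m.ctr .base)).flatMap CircuitNode.code))
    (fun i _ => by simp) (fun i hi => by
      refine ((runs_inc _ _).seq (runs_inc _ _)).of_eq ?_ le_rfl
      ext1
      case ctr =>
        funext c
        by_cases h : c = .todo <;> by_cases h' : c = .done <;> by_cases h'' : c = .base <;>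
          simp_all [add_assoc]
      all_goals rfl)
  have e : m = ((({ m with
        inp := (((List.range n).drop 0).flatMap fun v => rowBits q (p v) ++ [some none]) ++ r
        save := (matrix 0 q p).reverse ++ m.save } : Mem).set .todo (n - 0)).set .done 0).write
          ((layer gate 0 q p (m.ctr d) (m.ctr .base)).flatMap CircuitNode.code) := by
    ext1
    case ctr =>
      funext c
      by_cases h : c = .todo <;> by_cases h' : c = .done <;> simp_all
    all_goals simp [layer, matrix, hinp, Mem.write]
  refine Runs.of_start e ((h1.append h2 ?_).of_eq ?_ ?_)
  · have : (List.range n).drop n = [] := List.drop_eq_nil_of_le (by simp)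
    ext1 <;> simp [m₁, Mem.write, this]
  · rw [Nat.sub_self, Mem.set_eq_self (m := m₁.set _ _) (by simpa using htodo),
      Mem.set_eq_self (m := m₁.set _ _) (by simpa using hdone)]
  · nlinarith

/-- Move what has been read back to the input. -/
def rewind : Prog := .loop .save (fun _ => false) fun x => .push .inp x

theorem runs_rewind (m : Mem) :
    Runs rewind m (2 * m.save.length + 1)
      { m with inp := m.save.reverse ++ m.inp, save := [] } := by
  have h := runs_loop_save (ends := fun _ => false) (p := fun x => .push .inp x) (T := 1)
    m.save [] (fun i => { m with
      inp := (m.save.take i).reverse ++ m.inp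
      save := m.save.drop i }) (fun i _ => by simp) (fun _ _ => rfl) (by simp)
    (fun i hi => (runs_push_inp _ _).of_eq
      (by rw [List.take_succ_eq_append_getElem hi, List.reverse_append]; simp) le_rfl)
  exact h.of_eq (by ext1 <;> simp) le_rfl

/-- Write the two layers of a round. -/
def round : Prog := layerProg .or .base ;; layerProg .and .one ;; rewind

theorem length_matrix (n q : ℕ) (p : ℕ → ℕ → Bool) : (matrix n q p).length = n * (q + 1) := by
  simp [matrix, rowBits]

theorem runs_round (I : Data) (m : Mem) (D : ℕ)
    (htmp : m.ctr .tmp = 0) (hcol : m.ctr .col = 0) (hdone : m.ctr .done = 0)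
    (hone : m.ctr .one = 1) (htodo : m.ctr .todo = I.n)
    (hinp : m.inp = matrix I.n I.n I.adj ++ matrix I.n I.m I.col) (hsave : m.save = [])
    (hb : m.ctr .base + I.n ≤ D) (hm : I.m ≤ D) (h1 : 1 ≤ D) :
    Runs round m (40 * (D + 1) ^ 3)
      ((m.set .base (m.ctr .base + 2 * I.n)).write
        ((I.roundNodes (m.ctr .base)).flatMap CircuitNode.code)) := by
  have hn : I.n ≤ D := by omega
  refine ((runs_layerProg (gate := .or) (fun _ => rfl) .base (.inl rfl) I.n I.n I.adj m
    (matrix I.n I.m I.col) D htmp hcol hdone htodo hinp (by omega) hn (by omega) hn).seq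
    ((runs_layerProg (gate := .and) (fun _ => rfl) .one (.inr rfl) I.n I.m I.col _ [] D ?_ ?_ ?_ ?_
      ?_ ?_ hn ?_ hm).seq (runs_rewind _))).of_eq ?_ ?_
  · simpa using htmp
  · simpa using hcol
  · simpa using hdone
  · simpa using htodo
  · simp
  · simpa using hb
  · simpa [hone] using h1
  · ext1
    case ctr => simp [two_mul, add_assoc]
    all_goals simp [hinp, hsave, Mem.write, Data.roundNodes, hone]
  · simp [hsave, length_matrix]
    nlinarith [Nat.mul_le_mul hn hn, Nat.mul_le_mul hn hm]

/-! ### Reading the input and writing the output -/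

theorem runs_rounds (I : Data) (k : ℕ) (m : Mem) (D : ℕ)
    (htmp : m.ctr .tmp = 0) (hcol : m.ctr .col = 0) (hdone : m.ctr .done = 0)
    (hone : m.ctr .one = 1) (htodo : m.ctr .todo = I.n) (hrounds : m.ctr .rounds = I.n)
    (hbase : m.ctr .base = I.start k 0)
    (hinp : m.inp = matrix I.n I.n I.adj ++ matrix I.n I.m I.col) (hsave : m.save = [])
    (hb : I.start k I.n + I.n ≤ D) :
    Runs (countdown .rounds round) (m.write ((I.stage k 0).flatMap CircuitNode.code))
      ((40 * (D + 1) ^ 3 + 1) * I.n + 1)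
      (((m.set .base (I.start k I.n)).set .rounds 0).write
        ((I.stage k I.n).flatMap CircuitNode.code)) := by
  have h := runs_countdown (c := .rounds) (p := round) (T := 40 * (D + 1) ^ 3) I.n
    (fun i => ((m.set .base (I.start k i)).set .rounds (I.n - i)).write
      ((I.stage k i).flatMap CircuitNode.code))
    (fun i _ => by simp) (fun i hi => by
      have : I.n * i ≤ I.n * I.n := Nat.mul_le_mul_left _ hi.le
      have hst : I.start k i ≤ I.start k I.n := by
        simp only [Data.start]; nlinarith
      refine (runs_round I _ D (by simpa) (by simpa) (by simpa) (by simpa) (by simpa) (by simpa)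
        (by simpa) ?_ ?_ ?_).of_eq ?_ le_rfl
      · simp; omega
      · simp only [Data.start] at hb; omega
      · simp only [Data.start] at hb; omega
      · have : I.start k i + 2 * I.n = I.start k (i + 1) := by simp only [Data.start]; ring
        ext1
        case ctr =>
          funext c
          by_cases h : c = .base <;> by_cases h' : c = .rounds <;> simp_all
        all_goals simp [Mem.write, Data.stage])
  rw [Nat.sub_self, Nat.sub_zero, Mem.set_eq_self hbase, Mem.set_eq_self hrounds] at h
  exact h

/-- Write the next variable. -/
def literal : Prog := put (some .pos) ;; emit .base ;; inc .base

theorem runs_literal (m : Mem) (D : ℕ) (htmp : m.ctr .tmp = 0) (hb : m.ctr .base ≤ D) :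
    Runs literal m (5 * D + 4) ((m.set .base (m.ctr .base + 1)).write
      (CircuitNode.lit true (m.ctr .base)).code) := by
  refine ((runs_put_some _ _).seq ((runs_emit _ .base (by simp) (by simpa)).seq
    (runs_inc _ _))).of_eq ?_ ?_
  · simp [Mem.write, Mem.set, CircuitNode.code]
  · simp; omega

/-- The values of the counters while the input is read. -/
def counters (slack n rest base one src tgt : ℕ) : Counter → ℕ
  | .slack => slack
  | .todo => n
  | .rest => rest
  | .rounds => n
  | .base => base
  | .one => one
  | .src => src
  | .tgt => tgt
  | _ => 0

/-- The code of a number. -/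
def unaryBits (a : ℕ) : List (Option (Option Bool)) :=
  List.replicate a (some (some true)) ++ [some none]

/-- Whether a symbol ends a number in unary. -/
def notOne (x : Option (Option Bool)) : Bool := x != some (some true)

/-- The variables `0, …, i - 1`. -/
def literals (i : ℕ) : List CircuitSymbol :=
  ((List.range i).map (CircuitNode.lit true)).flatMap CircuitNode.code

theorem literals_succ (i : ℕ) : literals (i + 1) = literals i ++ (CircuitNode.lit true i).code := by
  simp [literals, List.range_succ]

/-- Read the parameter and the numbers of vertices and colors, and write the new parameter and the
variables. The loop that reads the parameter pops the first unit of the number of vertices, which is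
therefore counted separately. -/
def readSizes : Prog :=
  .loop .inp Option.isSome (fun _ => put none ;; inc .slack) ;;
    (inc .todo ;; inc .rounds ;; inc .rest) ;; put none ;; inc .one ;; literal ;;
      .loop .inp notOne (fun _ => inc .todo ;; inc .rounds ;; inc .rest) ;;
        .loop .inp notOne (fun _ => literal) ;; countdown .slack literal

theorem runs_readSizes (n m k D : ℕ) (hn : 0 < n) (hD : 1 + m + k ≤ D) (hnD : n ≤ D)
    (r : List (Option (Option Bool))) :
    Runs readSizes ⟨List.replicate k none ++ (unaryBits n ++ (unaryBits m ++ r)), [], [], [],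
      counters 0 0 0 0 0 0 0⟩ (40 * (D + 1) ^ 2)
      (Mem.write ⟨r, [], List.replicate (k + 1) none, [], counters 0 n n (1 + m + k) 1 0 0⟩
        (literals (1 + m + k))) := by
  have h1 := runs_loop_inp (ends := Option.isSome) (p := fun _ => put none ;; inc .slack) (T := 2)
    (List.replicate k none) (unaryBits n ++ (unaryBits m ++ r))
    (fun i => ⟨(List.replicate k none).drop i ++ (unaryBits n ++ (unaryBits m ++ r)), [],
      List.replicate i none, [], counters i 0 0 0 0 0 0⟩)
    -- The first symbol after the parameter is popped here; as `n` is positive, it is a `1`.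
    (fun i _ => rfl) (by simp) (by
      obtain ⟨n, rfl⟩ : ∃ n', n = n' + 1 := ⟨n - 1, by omega⟩
      simp [unaryBits, List.replicate_succ]) (fun i hi => by
      refine ((runs_put _ _).seq (runs_inc _ _)).of_eq ?_ le_rfl
      ext1
      case ctr => funext c; cases c <;> simp [counters]
      all_goals simp [List.replicate_succ])
  have h2 : Runs (inc .todo ;; inc .rounds ;; inc .rest)
      ⟨unaryBits (n - 1) ++ (unaryBits m ++ r), [], List.replicate k none, [],
        counters k 0 0 0 0 0 0⟩ 3
      ⟨unaryBits (n - 1) ++ (unaryBits m ++ r), [], List.replicate k none, [],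
        counters k 1 1 0 0 0 0⟩ := by
    refine ((runs_inc _ .todo).seq ((runs_inc _ .rounds).seq (runs_inc _ .rest))).of_eq ?_ le_rfl
    ext1
    case ctr => funext c; cases c <;> simp [counters]
    all_goals simp
  have h3 : Runs (inc .one)
      ⟨unaryBits (n - 1) ++ (unaryBits m ++ r), [], List.replicate (k + 1) none, [],
        counters k 1 1 0 0 0 0⟩ 1
      ⟨unaryBits (n - 1) ++ (unaryBits m ++ r), [], List.replicate (k + 1) none, [],
        counters k 1 1 0 1 0 0⟩ := by
    refine (runs_inc _ _).of_eq ?_ le_rfl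
    ext1
    case ctr => funext c; cases c <;> simp [counters]
    all_goals simp
  have h4 := runs_literal ⟨unaryBits (n - 1) ++ (unaryBits m ++ r), [],
    List.replicate (k + 1) none, [], counters k 1 1 0 1 0 0⟩ D rfl (Nat.zero_le _)
  have h5 := runs_loop_inp (ends := notOne) (p := fun _ => inc .todo ;; inc .rounds ;; inc .rest)
    (T := 3) (List.replicate (n - 1) (some (some true))) (some none :: (unaryBits m ++ r))
    (fun i => Mem.write ⟨(List.replicate (n - 1) (some (some true))).drop i ++
        some none :: (unaryBits m ++ r), [], List.replicate (k + 1) none, [],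
        counters k (i + 1) (i + 1) 1 1 0 0⟩ (literals 1))
    (fun i _ => rfl) (by simp [notOne]) (by simp [notOne]) (fun i hi => by
      refine ((runs_inc _ .todo).seq ((runs_inc _ .rounds).seq (runs_inc _ .rest))).of_eq ?_ le_rfl
      ext1
      case ctr => funext c; cases c <;> simp [counters]
      all_goals simp [Mem.write])
  have h6 := runs_loop_inp (ends := notOne) (p := fun _ => literal)
    (T := 5 * D + 4) (List.replicate m (some (some true))) (some none :: r)
    (fun i => Mem.write ⟨(List.replicate m (some (some true))).drop i ++
        some none :: r, [], List.replicate (k + 1) none, [],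
        counters k n n (1 + i) 1 0 0⟩ (literals (1 + i)))
    (fun i _ => rfl) (by simp [notOne]) (by simp [notOne]) (fun i hi => by
      rw [List.length_replicate] at hi
      refine (runs_literal _ D rfl (by simp [counters]; omega)).of_eq ?_ le_rfl
      ext1
      case ctr => funext c; cases c <;> simp [counters, add_assoc]
      all_goals simp [Mem.write, ← add_assoc, literals_succ, counters])
  have h7 := runs_countdown (c := .slack) (p := literal) (T := 5 * D + 4) k
    (fun i => Mem.write ⟨r, [], List.replicate (k + 1) none, [],
        counters (k - i) n n (1 + m + i) 1 0 0⟩ (literals (1 + m + i)))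
    (fun i _ => rfl) (fun i hi => by
      refine (runs_literal _ D rfl (by simp [counters]; omega)).of_eq ?_ le_rfl
      ext1
      case ctr => funext c; cases c <;> simp [counters, add_assoc]
      all_goals simp [Mem.write, ← add_assoc, literals_succ, counters])
  have h := h1.append (h2.seq ((runs_put _ none).append (h3.append (h4.append (h5.append
    (h6.append h7 ?_) ?_) ?_) ?_) (by simp [List.replicate_succ]))) ?_
  · refine (Runs.of_start ?_ h).of_eq ?_ ?_
    · simp
    · simp
    · have h8 : k * D ≤ D * D := Nat.mul_le_mul_right _ (by omega)
      have h9 : m * D ≤ D * D := Nat.mul_le_mul_right _ (by omega)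
      have h10 : n - 1 ≤ D := by omega
      simp
      nlinarith
  · ext1 <;> simp [Mem.write]
  · ext1
    case ctr => funext c; cases c <;> simp [counters, Nat.sub_add_cancel hn]
    all_goals simp [Mem.write, unaryBits]
  · ext1
    case ctr => funext c; cases c <;> simp [counters]
    all_goals simp [Mem.write, unaryBits, literals, counters]
  · rfl
  · obtain ⟨n, rfl⟩ : ∃ n', n = n' + 1 := ⟨n - 1, by omega⟩
    simp [unaryBits, List.replicate_succ]

/-- Read the source and the target, which end the input, and write the first layer. Reading
backwards from the end consumes the last separator of the matrices, which is then put back. -/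
def readEnds : Prog :=
  .loop .inp (fun _ => false) keep ;; .loop .save (fun _ => true) (fun _ => .skip) ;;
    .loop .save notOne (fun _ => inc .tgt) ;;
      .loop .save notOne (fun _ => put (some .neg) ;; inc .src ;; dec .rest) ;;
        (keep (some none) ;; put (some .pos) ;; dec .rest) ;; countdown .rest (put (some .neg)) ;;
          rewind

theorem runs_readEnds (n s t b : ℕ) (hs : s < n) (Z : List (Option (Option Bool)))
    (rv : List (Option CircuitSymbol)) :
    Runs readEnds ⟨Z ++ some none :: (unaryBits s ++ unaryBits t), [], rv, [],
      counters 0 n n b 1 0 0⟩ (4 * Z.length + 10 * n + 10 * t + 20)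
      (Mem.write ⟨Z ++ [some none], [], rv, [], counters 0 n 0 b 1 s t⟩
        (List.replicate s .neg ++ .pos :: List.replicate (n - 1 - s) .neg)) := by
  have h1 := runs_loop_inp (ends := fun _ => false) (p := keep) (T := 1)
    (Z ++ some none :: (unaryBits s ++ unaryBits t)) []
    (fun i => ⟨(Z ++ some none :: (unaryBits s ++ unaryBits t)).drop i ++ [],
      ((Z ++ some none :: (unaryBits s ++ unaryBits t)).take i).reverse, rv, [],
      counters 0 n n b 1 0 0⟩)
    (fun i _ => rfl) (by simp) (by simp)
    (fun i hi => (runs_keep _ _).of_eq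
      (by rw [List.take_succ_eq_append_getElem hi, List.reverse_append]; rfl) le_rfl)
  have h2 := runs_loop_save (ends := fun _ => true) (p := fun _ => .skip) (T := 0) []
    (some none :: (List.replicate t (some (some true)) ++
        some none :: (List.replicate s (some (some true)) ++ some none :: Z.reverse)))
    (fun _ => ⟨[], some none :: (List.replicate t (some (some true)) ++
        some none :: (List.replicate s (some (some true)) ++ some none :: Z.reverse)), rv, [],
      counters 0 n n b 1 0 0⟩)
    (fun i _ => by simp) (by simp) (by simp) (by simp)
  have h3 := runs_loop_save (ends := notOne) (p := fun _ => inc .tgt) (T := 1)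
    (List.replicate t (some (some true)))
    (some none :: (List.replicate s (some (some true)) ++ some none :: Z.reverse))
    (fun i => ⟨[], (List.replicate t (some (some true))).drop i ++
        some none :: (List.replicate s (some (some true)) ++ some none :: Z.reverse), rv, [],
      counters 0 n n b 1 0 i⟩)
    (fun i _ => rfl) (by simp [notOne]) (by simp [notOne]) (fun i hi => by
      refine (runs_inc _ _).of_eq ?_ le_rfl
      ext1
      case ctr => funext c; cases c <;> simp [counters]
      all_goals simp)
  have h4 := runs_loop_save (ends := notOne)
    (p := fun _ => put (some .neg) ;; inc .src ;; dec .rest) (T := 3)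
    (List.replicate s (some (some true))) (some none :: Z.reverse)
    (fun i => Mem.write ⟨[], (List.replicate s (some (some true))).drop i ++
        some none :: Z.reverse, rv, [], counters 0 n (n - i) b 1 i t⟩ (List.replicate i .neg))
    (fun i _ => rfl) (by simp [notOne]) (by simp [notOne]) (fun i hi => by
      refine ((runs_put_some _ _).seq ((runs_inc _ _).seq (runs_dec _ _))).of_eq ?_ le_rfl
      ext1
      case ctr => funext c; cases c <;> simp [counters, Nat.sub_sub]
      all_goals simp [Mem.write, List.replicate_succ'])
  have h5 : Runs (keep (some none) ;; put (some .pos) ;; dec .rest)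
      (Mem.write ⟨[], Z.reverse, rv, [], counters 0 n (n - s) b 1 s t⟩ (List.replicate s .neg)) 3
      (Mem.write ⟨[], some none :: Z.reverse, rv, [], counters 0 n (n - 1 - s) b 1 s t⟩
        (List.replicate s .neg ++ [.pos])) := by
    refine ((runs_keep _ _).seq ((runs_put_some _ _).seq (runs_dec _ _))).of_eq ?_ le_rfl
    ext1
    case ctr => funext c; cases c <;> simp [counters]; omega
    all_goals simp [Mem.write]
  have h6 := runs_countdown (c := .rest) (p := put (some .neg)) (T := 1) (n - 1 - s)
    (fun i => Mem.write ⟨[], some none :: Z.reverse, rv, [], counters 0 n (n - 1 - s - i) b 1 s t⟩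
        (List.replicate s .neg ++ .pos :: List.replicate i .neg))
    (fun i _ => rfl) (fun i hi => by
      refine (runs_put_some _ _).of_eq ?_ le_rfl
      ext1
      case ctr => funext c; cases c <;> simp [counters]
      all_goals simp [Mem.write, List.replicate_succ'])
  have h := h1.append (h2.append (h3.append (h4.append (h5.append (h6.append
    (runs_rewind (Mem.write ⟨[], some none :: Z.reverse, rv, [], counters 0 n 0 b 1 s t⟩
      (List.replicate s .neg ++ .pos :: List.replicate (n - 1 - s) .neg))) ?_) ?_) ?_) ?_) ?_) ?_
  · refine (Runs.of_start ?_ h).of_eq ?_ ?_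
    · simp
    · ext1 <;> simp [Mem.write]
    · simp [unaryBits]
      omega
  · ext1
    case ctr => funext c; cases c <;> simp [counters]
    all_goals simp [Mem.write]
  · ext1 <;> simp [Mem.write]
  · ext1 <;> simp [Mem.write]
  · ext1 <;> simp [Mem.write]
  · ext1 <;> simp
  · ext1 <;> simp [unaryBits]

/-- Clear all stacks but the reversed output, and reverse the latter. -/
def cleanUp : Prog :=
  .loop .inp (fun _ => false) (fun _ => .skip) ;; clear .todo ;; clear .base ;; clear .one ;;
    clear .src ;; clear .tgt ;; .loop .rev (fun _ => false) fun x => .push .out x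

theorem runs_cleanUp (l : List (Option (Option Bool))) (rv : List (Option CircuitSymbol))
    (c : Counter → ℕ) (n b s t : ℕ)
    (hc : c = Function.update (counters 0 n 0 b 1 s t) .rounds 0) :
    Runs cleanUp ⟨l, [], rv, [], c⟩
      (2 * l.length + 2 * (n + b + s + t) + 2 * rv.length + 20)
      ⟨[], [], [], rv.reverse, counters 0 0 0 0 0 0 0⟩ := by
  have h1 := runs_loop_inp (ends := fun _ => false) (p := fun _ => .skip) (T := 1) l []
    (fun i => ⟨l.drop i ++ [], [], rv, [], c⟩) (fun i _ => rfl) (by simp) (by simp)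
    (fun i hi => .skip)
  have h2 := runs_loop_rev (p := fun x => .push .out x) (T := 1) rv
    (fun i => ⟨[], [], rv.drop i, (rv.take i).reverse, counters 0 0 0 0 0 0 0⟩) (fun i _ => rfl)
    (fun i hi => (runs_push_out _ _).of_eq
      (by rw [List.take_succ_eq_append_getElem hi, List.reverse_append]; rfl) le_rfl)
  have h := h1.seq ((runs_clear _ .todo).seq ((runs_clear _ .base).seq ((runs_clear _ .one).seq
    ((runs_clear _ .src).seq ((runs_clear _ .tgt).append h2 ?_)))))
  · subst hc
    refine (Runs.of_start ?_ h).of_eq ?_ ?_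
    · simp
    · simp
    · simp [counters]
      omega
  · subst hc
    ext1
    case ctr => funext c; cases c <;> simp [counters]
    all_goals simp

/-- Write the two gates of the output, and clean up. -/
def finish : Prog :=
  put (some .and) ;; put (some .sep) ;; ref .base .src ;; put (some .and) ;; ref .base .todo ;;
    ref .base .tgt ;; cleanUp

theorem runs_finish (m : Mem) (n b s t : ℕ) (hsave : m.save = []) (hout : m.out = [])
    (hc : m.ctr = Function.update (counters 0 n 0 b 1 s t) .rounds 0) :
    Runs finish m (2 * m.inp.length + 25 * (n + b + s + t) + 2 * m.rev.length + 60)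
      ⟨[], [], [], m.rev.reverse ++ (([.and [0, b + s], .and [b + n, b + t]] :
        List CircuitNode).flatMap CircuitNode.code).map some, counters 0 0 0 0 0 0 0⟩ := by
  have htmp : m.ctr .tmp = 0 := by simp [hc, counters]
  refine ((runs_put_some _ _).seq ((runs_put_some _ _).seq ((runs_ref _ .base .src (by simp)
    (by simp) (by simpa using htmp)).seq ((runs_put_some _ _).seq ((runs_ref _ .base .todo (by simp)
    (by simp) (by simpa using htmp)).seq ((runs_ref _ .base .tgt (by simp)
    (by simp) (by simpa using htmp)).append (runs_cleanUp m.inp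
      ((((([.and [0, b + s], .and [b + n, b + t]] :
        List CircuitNode).flatMap CircuitNode.code).map some).reverse) ++ m.rev)
      m.ctr n b s t hc) ?_)))))).of_eq ?_ ?_
  · ext1 <;> simp [hsave, hout, Mem.write, hc, counters, CircuitNode.code]
  · simp
  · simp [hc, counters, CircuitNode.code]
    omega

/-- The program of the reduction. -/
def program : Prog := readSizes ;; readEnds ;; countdown .rounds round ;; finish

/-- The input of the program: the parameter in unary, and the code of the instance. -/
def Data.word (I : Data) (k : ℕ) : List (Option (Option Bool)) :=
  List.replicate k none ++ (unaryBits I.n ++ (unaryBits I.m ++ (matrix I.n I.n I.adj ++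
    matrix I.n I.m I.col ++ (unaryBits I.s ++ unaryBits I.t))))

/-- The code of the first layer. -/
theorem code_sources (n s : ℕ) (hs : s < n) :
    ((List.range n).map fun v => CircuitNode.lit (decide (v = s)) 0).flatMap CircuitNode.code =
      List.replicate s .neg ++ .pos :: List.replicate (n - 1 - s) .neg := by
  obtain ⟨r, rfl⟩ : ∃ r, n = s + (r + 1) := ⟨n - 1 - s, by omega⟩
  have h1 : ∀ l : List ℕ, (∀ v ∈ l, v ≠ s) →
      (l.map fun v => CircuitNode.lit (decide (v = s)) 0).flatMap CircuitNode.code =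
        List.replicate l.length .neg := by
    intro l hl
    induction l with
    | nil => rfl
    | cons v l ih =>
      have hv : v ≠ s := hl v (by simp)
      simp only [List.map_cons, List.flatMap_cons, ih fun v hv => hl v (by simp [hv])]
      simp [hv, CircuitNode.code, List.replicate_succ]
  rw [List.range_add, List.range_succ_eq_map, List.map_append, List.flatMap_append,
    h1 _ (by simp; omega), List.map_cons, List.map_cons, List.flatMap_cons, h1 _ (by simp)]
  simp [CircuitNode.code]

theorem runs_program (I : Data) (k : ℕ) (hs : I.s < I.n) (ht : I.t < I.n) :
    Runs program ⟨I.word k, [], [], [], counters 0 0 0 0 0 0 0⟩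
      (256000 * (I.n + I.m + k + 1) ^ 8)
      ⟨[], [], [], List.replicate (k + 1) none ++
        ((I.nodes k).flatMap CircuitNode.code).map some, counters 0 0 0 0 0 0 0⟩ := by
  obtain ⟨n, m, adj, col, s, t⟩ := I
  simp only at hs ht
  set I : Data := ⟨n, m, adj, col, s, t⟩
  set w := n + m + k + 1
  -- `D` bounds all counters and the length of the matrices.
  set D := 3 * w ^ 2
  have hw : w ≤ w ^ 2 := Nat.le_self_pow (by simp) _
  have hnw : n * (n + m + 1) ≤ w ^ 2 := by
    rw [pow_two]; exact Nat.mul_le_mul (by omega) (by omega)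
  have hmul : n * (n + m + 1) = n * n + n * m + n := by ring
  have h1 := runs_readSizes n m k D (by omega) (by omega) (by omega) (matrix n n adj ++
    matrix n m col ++ (unaryBits s ++ unaryBits t))
  obtain ⟨Z, hZ⟩ : ∃ Z, matrix n n adj ++ matrix n m col = Z ++ [some none] := by
    obtain ⟨n, rfl⟩ : ∃ n', n = n' + 1 := ⟨n - 1, by omega⟩
    exact ⟨matrix (n + 1) (n + 1) adj ++ (matrix n m col ++ rowBits m (col n)), by
      simp [matrix, List.range_succ]⟩
  have hZD : Z.length + 1 ≤ D := by
    have : Z.length + 1 = n * (n + 1) + n * (m + 1) := by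
      rw [← length_matrix n n adj, ← length_matrix n m col, ← List.length_append, hZ]
      simp
    rw [this, mul_add, mul_add]
    omega
  have h2 := runs_readEnds n s t (1 + m + k) hs Z
    (((literals (1 + m + k)).map some).reverse ++ List.replicate (k + 1) none)
  have hstart : I.start k n = 1 + m + k + 2 * (n * n) := by simp only [Data.start, I]; ring
  have hb : I.start k n + n ≤ D := by omega
  have h3 := runs_rounds I k ⟨Z ++ [some none], [], List.replicate (k + 1) none, [],
    counters 0 n 0 (1 + m + k) 1 s t⟩ D rfl rfl rfl rfl rfl rfl (by simp [counters, Data.start, I])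
    hZ.symm rfl hb
  have e1 : Mem.write ⟨matrix n n adj ++ matrix n m col ++ (unaryBits s ++ unaryBits t), [],
      List.replicate (k + 1) none, [], counters 0 n n (1 + m + k) 1 0 0⟩ (literals (1 + m + k)) =
      ⟨Z ++ some none :: (unaryBits s ++ unaryBits t), [],
        ((literals (1 + m + k)).map some).reverse ++ List.replicate (k + 1) none, [],
        counters 0 n n (1 + m + k) 1 0 0⟩ := by
    rw [hZ]; simp [Mem.write]
  have e2 : Mem.write ⟨Z ++ [some none], [],
      ((literals (1 + m + k)).map some).reverse ++ List.replicate (k + 1) none, [],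
        counters 0 n 0 (1 + m + k) 1 s t⟩
        (List.replicate s .neg ++ .pos :: List.replicate (n - 1 - s) .neg) =
      Mem.write ⟨Z ++ [some none], [], List.replicate (k + 1) none, [],
        counters 0 n 0 (1 + m + k) 1 s t⟩ ((I.stage k 0).flatMap CircuitNode.code) := by
    rw [Data.stage, List.flatMap_append, code_sources n s hs]
    simp [Mem.write, literals, I]
  -- The reversed output is at most as long as the time taken so far.
  have hlen := (h1.append (h2.append h3 e2) e1).length_le .rev
  set m₃ := ((Mem.set ⟨Z ++ [some none], [], List.replicate (k + 1) none, [],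
    counters 0 n 0 (1 + m + k) 1 s t⟩ .base (I.start k I.n)).set .rounds 0).write
      ((I.stage k I.n).flatMap CircuitNode.code) with hm₃
  have h4 := runs_finish m₃ n (I.start k n) s t rfl rfl (by
    funext c; cases c <;> simp [m₃, counters, I])
  refine (h1.append (h2.append (h3.seq h4) e2) e1).of_eq ?_ ?_
  · simp [m₃, Mem.write, Data.nodes, I]
  · replace hlen : m₃.rev.length ≤ 0 + _ := hlen
    have hinp : m₃.inp.length = Z.length + 1 := by simp [m₃]
    simp only [hinp]
    -- All in all at most `1000 * (D + 1) ^ 4` steps are made.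
    have hD : D + 1 ≤ 4 * w ^ 2 := by
      have : 1 ≤ w ^ 2 := Nat.one_le_pow _ _ (by omega)
      omega
    have hE4 : (D + 1) ^ 4 ≤ 256 * w ^ 8 := by
      calc (D + 1) ^ 4 ≤ (4 * w ^ 2) ^ 4 := Nat.pow_le_pow_left hD 4
        _ = 256 * w ^ 8 := by ring
    have hE1 : D + 1 ≤ (D + 1) ^ 4 := Nat.le_self_pow (by simp) _
    have hE2 : (D + 1) ^ 2 ≤ (D + 1) ^ 4 := Nat.pow_le_pow_right (by omega) (by simp)
    have hE3 : (40 * (D + 1) ^ 3 + 1) * n + 1 ≤ 41 * (D + 1) ^ 4 := by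
      have h : (D + 1) ^ 3 * n ≤ (D + 1) ^ 3 * (D + 1) := Nat.mul_le_mul_left _ (by omega)
      have e : (D + 1) ^ 3 * (D + 1) = (D + 1) ^ 4 := by ring
      have e' : (40 * (D + 1) ^ 3 + 1) * n = 40 * ((D + 1) ^ 3 * n) + n := by ring
      omega
    have hIn : I.n = n := rfl
    rw [hIn] at hlen ⊢
    omega

end ColoredPath

/-! ### Values in circuits -/

namespace BoolCircuit

variable {C : BoolCircuit} {S : Finset ℕ} {i : ℕ}

theorem value_lit_true {x : ℕ} (h : C.nodes[i]? = some (.lit true x)) : C.Value S i ↔ x ∈ S := by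
  rw [Value, h]

theorem value_lit_false {x : ℕ} (h : C.nodes[i]? = some (.lit false x)) :
    C.Value S i ↔ x ∉ S := by
  rw [Value, h]

theorem lt_of_mem_inputs {v : CircuitNode} {j : ℕ} (h : C.nodes[i]? = some v)
    (hj : j ∈ v.inputs) : j < i := by
  obtain ⟨hi, rfl⟩ := List.getElem?_eq_some_iff.1 h
  exact C.inputs_lt i hi j hj

theorem value_and {l : List ℕ} (h : C.nodes[i]? = some (.and l)) :
    C.Value S i ↔ ∀ j ∈ l, C.Value S j := by
  rw [Value, h]
  exact forall₂_congr fun j hj => ⟨fun ⟨_, h⟩ => h, fun h' => ⟨lt_of_mem_inputs h hj, h'⟩⟩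

theorem value_or {l : List ℕ} (h : C.nodes[i]? = some (.or l)) :
    C.Value S i ↔ ∃ j ∈ l, C.Value S j := by
  rw [Value, h]
  exact exists_congr fun j =>
    and_congr_right fun hj => ⟨fun ⟨_, h⟩ => h, fun h' => ⟨lt_of_mem_inputs h hj, h'⟩⟩

end BoolCircuit

namespace ColoredPath

/-! ### Correctness of the circuit -/

namespace Data

variable (I : Data) (k : ℕ)

theorem length_stage (l : ℕ) : (I.stage k l).length = I.start k l + I.n := by
  induction l with
  | zero => simp [stage, start]
  | succ l ih => simp [stage, ih, roundNodes, layer, start]; ring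

theorem stage_prefix {i j : ℕ} (h : i ≤ j) : I.stage k i <+: I.stage k j := by
  induction j, h using Nat.le_induction with
  | base => exact List.prefix_rfl
  | succ j _ ih => exact ih.trans (List.prefix_append _ _)

theorem stage_prefix_nodes {i : ℕ} (h : i ≤ I.n) : I.stage k i <+: I.nodes k :=
  (I.stage_prefix k h).trans (List.prefix_append _ _)

theorem nodes_getElem?_of_stage {i j : ℕ} {v : CircuitNode} (h : i ≤ I.n)
    (hv : (I.stage k i)[j]? = some v) : (I.nodes k)[j]? = some v := by
  obtain ⟨r, hr⟩ := I.stage_prefix_nodes k h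
  rw [← hr, List.getElem?_append_left (List.getElem?_eq_some_iff.1 hv).1, hv]

theorem nodes_variable {x : ℕ} (h : x < 1 + I.m + k) :
    (I.nodes k)[x]? = some (.lit true x) := by
  refine I.nodes_getElem?_of_stage k (Nat.zero_le _) ?_
  rw [stage, List.getElem?_append_left (by simpa), List.getElem?_map, List.getElem?_range h]
  rfl

theorem nodes_source {v : ℕ} (h : v < I.n) :
    (I.nodes k)[I.start k 0 + v]? = some (.lit (decide (v = I.s)) 0) := by
  refine I.nodes_getElem?_of_stage k (Nat.zero_le _) ?_
  rw [stage, List.getElem?_append_right (by simp [start])]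
  simp [start, h]

theorem nodes_or {i v : ℕ} (hi : i < I.n) (h : v < I.n) :
    (I.nodes k)[I.start k i + I.n + v]? = some (.or ((I.start k i + v) ::
      ((List.range I.n).filter (I.adj v)).map (I.start k i + ·))) := by
  refine I.nodes_getElem?_of_stage k (i := i + 1) hi ?_
  rw [stage, List.getElem?_append_right (by simp [length_stage]), roundNodes,
    List.getElem?_append_left (by simp [length_stage, layer, h])]
  simp [length_stage, layer, h]

theorem nodes_and {i v : ℕ} (hi : i < I.n) (h : v < I.n) :
    (I.nodes k)[I.start k (i + 1) + v]? = some (.and ((I.start k i + I.n + v) ::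
      ((List.range I.m).filter (I.col v)).map (1 + ·))) := by
  refine I.nodes_getElem?_of_stage k (i := i + 1) hi ?_
  have e : I.start k (i + 1) + v = (I.stage k i).length + (I.n + v) := by
    simp only [length_stage, start]; ring
  rw [e, stage, List.getElem?_append_right (by simp), roundNodes,
    List.getElem?_append_right (by simp [layer])]
  simp [layer, h]

/-- The conditions on the data of a graph under which the nodes form a circuit. -/
structure Valid : Prop where
  s_lt : I.s < I.n
  t_lt : I.t < I.n
  adj_self : ∀ v, I.adj v v = false

/-- The in-neighbours of each node come before it. -/
def Topological (L : List CircuitNode) : Prop :=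
  ∀ (i : ℕ) (v : CircuitNode), L[i]? = some v → ∀ j ∈ v.inputs, j < i

theorem Topological.append {L L' : List CircuitNode} (h : Topological L)
    (h' : ∀ v ∈ L', ∀ j ∈ v.inputs, j < L.length) : Topological (L ++ L') := by
  intro i v hv j hj
  by_cases hi : i < L.length
  · exact h i v (by rwa [List.getElem?_append_left hi] at hv) j hj
  · rw [List.getElem?_append_right (not_lt.1 hi)] at hv
    exact (h' v (List.mem_of_getElem? hv) j hj).trans_le (not_lt.1 hi)

theorem inputs_lt_of_mem_layer {gate : List ℕ → CircuitNode} (hg : ∀ l, (gate l).inputs = l)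
    {n q : ℕ} {p : ℕ → ℕ → Bool} {d B b : ℕ} (hB : B + n ≤ b) (hd : d + q ≤ b) :
    ∀ v ∈ layer gate n q p d B, ∀ j ∈ v.inputs, j < b := by
  simp only [layer, List.mem_map, List.mem_range]
  rintro _ ⟨v, hv, rfl⟩ j hj
  simp only [hg, List.mem_cons, List.mem_map, List.mem_filter, List.mem_range] at hj
  omega

theorem topological_stage (l : ℕ) : Topological (I.stage k l) := by
  induction l with
  | zero =>
    intro i v hv j hj
    have := List.mem_of_getElem? hv
    simp only [stage, List.mem_append, List.mem_map] at this
    obtain ⟨x, -, rfl⟩ | ⟨x, -, rfl⟩ := this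
    all_goals simp [CircuitNode.inputs] at hj
  | succ l ih =>
    rw [stage, roundNodes, ← List.append_assoc]
    refine (ih.append (inputs_lt_of_mem_layer (fun _ => rfl) ?_ ?_)).append
      (inputs_lt_of_mem_layer (fun _ => rfl) ?_ ?_)
    all_goals simp [length_stage, layer, start]
    omega

theorem topological_nodes (h : I.Valid) : Topological (I.nodes k) := by
  have hs := h.s_lt
  have ht := h.t_lt
  rw [nodes, ← List.singleton_append, ← List.append_assoc]
  refine ((I.topological_stage k I.n).append ?_).append ?_
  · simp [CircuitNode.inputs, length_stage]
    omega
  · simp [CircuitNode.inputs, length_stage]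
    omega

/-- The conditions of a circuit on a single node. -/
def Proper (v : CircuitNode) : Prop := v.inputs.Nodup ∧ (v.IsGate → v.inputs ≠ [])

theorem proper_of_mem_layer {gate : List ℕ → CircuitNode} (hg : ∀ l, (gate l).inputs = l)
    {n q : ℕ} {p : ℕ → ℕ → Bool} {d B : ℕ}
    (h : ∀ v < n, ∀ u < q, p v u = true → d + u ≠ B + v) :
    ∀ v ∈ layer gate n q p d B, Proper v := by
  simp only [layer, List.mem_map, List.mem_range]
  rintro _ ⟨v, hv, rfl⟩
  refine ⟨?_, by simp [hg]⟩
  rw [hg, List.nodup_cons]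
  refine ⟨?_, (List.nodup_range.filter _).map (add_right_injective d)⟩
  simp only [List.mem_map, List.mem_filter, List.mem_range]
  rintro ⟨u, ⟨hu, hp⟩, e⟩
  exact h v hv u hu hp e

theorem proper_of_mem_nodes (h : I.Valid) : ∀ v ∈ I.nodes k, Proper v := by
  have hst : ∀ l, ∀ v ∈ I.stage k l, Proper v := by
    intro l
    induction l with
    | zero =>
      intro v hv
      simp only [stage, List.mem_append, List.mem_map] at hv
      obtain ⟨x, -, rfl⟩ | ⟨x, -, rfl⟩ := hv
      all_goals simp [Proper, CircuitNode.inputs, CircuitNode.IsGate]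
    | succ l ih =>
      intro v hv
      simp only [stage, roundNodes, List.mem_append] at hv
      obtain hv | hv | hv := hv
      · exact ih v hv
      · refine proper_of_mem_layer (fun _ => rfl) (fun v _ u _ huv e => ?_) v hv
        obtain rfl : u = v := by omega
        simp [h.adj_self] at huv
      · refine proper_of_mem_layer (fun _ => rfl) (fun v _ u hu _ e => ?_) v hv
        simp only [start] at e
        omega
  intro v hv
  have hs := h.s_lt
  have ht := h.t_lt
  simp only [nodes, List.mem_append, List.mem_cons, List.not_mem_nil, or_false] at hv
  obtain hv | rfl | rfl := hv
  · exact hst _ v hv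
  · simp [Proper, CircuitNode.inputs, start]
    omega
  · simp [Proper, CircuitNode.inputs]
    omega

variable {I}

/-- The circuit of the reduction. -/
def circuit (h : I.Valid) : BoolCircuit where
  nodes := I.nodes k
  inputs_lt := fun i hi => I.topological_nodes k h i _ (List.getElem?_eq_getElem hi)
  inputs_nodup := fun v hv => (I.proper_of_mem_nodes k h v hv).1
  gate_inputs_ne_nil := fun v hv => (I.proper_of_mem_nodes k h v hv).2
  output_isGate := ⟨.and [I.start k I.n + I.n, I.start k I.n + I.t], by simp [nodes], trivial⟩

variable (S : Finset ℕ)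

variable (I) in
/-- What the node of `v` in the last layer says after `l` rounds. If `S` contains the variable `0`,
then only the source is reached at first. A round adds the neighbours of the vertices that are
reached, and then removes the vertices that have a color outside of `S`. -/
def Reach : ℕ → ℕ → Prop
  | 0, v => v = I.s ↔ 0 ∈ S
  | l + 1, v => (Reach l v ∨ ∃ u < I.n, I.adj v u = true ∧ Reach l u) ∧
      ∀ c < I.m, I.col v c = true → 1 + c ∈ S

theorem value_layer (h : I.Valid) {l v : ℕ} (hl : l ≤ I.n) (hv : v < I.n) :
    (circuit k h).Value S (I.start k l + v) ↔ I.Reach S l v := by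
  induction l generalizing v with
  | zero =>
    have : (circuit k h).nodes[I.start k 0 + v]? = _ := I.nodes_source k hv
    by_cases e : v = I.s
    · rw [BoolCircuit.value_lit_true (x := 0) (by rw [this]; simp [e]), Reach]
      simp [e]
    · rw [BoolCircuit.value_lit_false (x := 0) (by rw [this]; simp [e]), Reach]
      simp [e]
  | succ l ih =>
    have hm : ∀ c < I.m, (circuit k h).Value S (1 + c) ↔ 1 + c ∈ S := fun c hc =>
      BoolCircuit.value_lit_true (I.nodes_variable k (by omega))
    rw [BoolCircuit.value_and (I.nodes_and k hl hv), Reach]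
    simp only [List.forall_mem_cons, List.mem_map, List.mem_filter, List.mem_range,
      forall_exists_index, and_imp]
    rw [BoolCircuit.value_or (I.nodes_or k hl hv)]
    simp only [List.exists_mem_cons_iff, List.mem_map, List.mem_filter, List.mem_range]
    refine and_congr (or_congr (ih (by omega) hv) ⟨?_, ?_⟩) ?_
    · rintro ⟨_, ⟨u, ⟨hu, hvu⟩, rfl⟩, h⟩
      exact ⟨u, hu, hvu, (ih (by omega) hu).1 h⟩
    · rintro ⟨u, hu, hvu, h⟩
      exact ⟨_, ⟨u, ⟨hu, hvu⟩, rfl⟩, (ih (by omega) hu).2 h⟩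
    · exact ⟨fun H c hc hvc => (hm c hc).1 (H _ c hc hvc rfl),
        fun H _ c hc hvc e => e ▸ (hm c hc).2 (H c hc hvc)⟩

theorem value_output (h : I.Valid) :
    (circuit k h).Value S ((I.nodes k).length - 1) ↔
      0 ∈ S ∧ I.Reach S I.n I.s ∧ I.Reach S I.n I.t := by
  have h1 : (circuit k h).nodes[I.start k I.n + I.n]? =
      some (.and [0, I.start k I.n + I.s]) := by
    simp [circuit, nodes, length_stage]
  have h2 : (circuit k h).nodes[(I.nodes k).length - 1]? =
      some (.and [I.start k I.n + I.n, I.start k I.n + I.t]) := by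
    simp [circuit, nodes]
  rw [BoolCircuit.value_and h2]
  simp only [List.forall_mem_cons, List.not_mem_nil, IsEmpty.forall_iff, implies_true, and_true]
  rw [BoolCircuit.value_and h1]
  simp only [List.forall_mem_cons, List.not_mem_nil, IsEmpty.forall_iff, implies_true, and_true]
  rw [BoolCircuit.value_lit_true (I.nodes_variable k (by omega)), value_layer k S h le_rfl h.s_lt,
    value_layer k S h le_rfl h.t_lt, and_assoc]

end Data

/-! ### Walks in the graph -/

open Classical in
/-- The data of an input of Colored Path. -/
noncomputable def data (G : ColoredGraph) : Data where
  n := G.n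
  m := G.m
  adj v u := if h : v < G.n ∧ u < G.n then decide (G.G.Adj ⟨v, h.1⟩ ⟨u, h.2⟩) else false
  col v c := if h : v < G.n ∧ c < G.m then decide (⟨c, h.2⟩ ∈ G.χ ⟨v, h.1⟩) else false
  s := G.s
  t := G.t

variable (G : ColoredGraph)

theorem data_valid : (data G).Valid where
  s_lt := G.s.2
  t_lt := G.t.2
  adj_self v := by simp [data]

theorem data_adj (v u : Fin G.n) : (data G).adj v u = true ↔ G.G.Adj v u := by
  simp [data]

theorem data_col (v : Fin G.n) (c : Fin G.m) : (data G).col v c = true ↔ c ∈ G.χ v := by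
  simp [data]

variable {G} (S : Finset ℕ)

/-- All colors of the vertex belong to `S`. -/
def Allowed (v : Fin G.n) : Prop := ∀ c ∈ G.χ v, 1 + (c : ℕ) ∈ S

theorem reach_succ (l : ℕ) (v : Fin G.n) :
    (data G).Reach S (l + 1) v ↔ ((data G).Reach S l v ∨
      ∃ u, G.G.Adj v u ∧ (data G).Reach S l u) ∧ Allowed S v := by
  rw [Data.Reach]
  refine and_congr (or_congr_right ⟨?_, ?_⟩) ⟨?_, ?_⟩
  · rintro ⟨u, hu, hvu, h⟩
    exact ⟨⟨u, hu⟩, (data_adj G v ⟨u, hu⟩).1 hvu, h⟩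
  · rintro ⟨u, hvu, h⟩
    exact ⟨u, u.2, (data_adj G v u).2 hvu, h⟩
  · exact fun h c hc => h c c.2 ((data_col G v c).2 hc)
  · exact fun h c hc hvc => h ⟨c, hc⟩ ((data_col G v ⟨c, hc⟩).1 hvc)

variable {S}

/-- The vertices that are reached can be reached by allowed walks. The hypothesis on the source is
needed because no round tests the source before its neighbours are added. -/
theorem exists_walk_of_reach (h0 : 0 ∈ S) (hs : Allowed S G.s) (l : ℕ) (v : Fin G.n)
    (h : (data G).Reach S l v) : ∃ p : G.G.Walk G.s v, ∀ u ∈ p.support, Allowed S u := by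
  induction l generalizing v with
  | zero =>
    obtain rfl : v = G.s := Fin.ext (h.2 h0)
    exact ⟨.nil, by simpa using hs⟩
  | succ l ih =>
    obtain ⟨h | ⟨u, hvu, h⟩, hv⟩ := (reach_succ S l v).1 h
    · exact ih v h
    · obtain ⟨p, hp⟩ := ih u h
      refine ⟨p.concat hvu.symm, fun w hw => ?_⟩
      rw [SimpleGraph.Walk.support_concat, List.mem_append, List.mem_singleton] at hw
      obtain hw | rfl := hw
      · exact hp w hw
      · exact hv

theorem reach_mono {l l' : ℕ} (h : l ≤ l') {v : Fin G.n} (hv : Allowed S v)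
    (hl : (data G).Reach S l v) : (data G).Reach S l' v := by
  induction l', h using Nat.le_induction with
  | base => exact hl
  | succ l' _ ih => exact (reach_succ S l' v).2 ⟨.inl ih, hv⟩

/-- The `i`-th vertex of an allowed walk is reached after `i + 1` rounds. -/
theorem reach_of_walk (h0 : 0 ∈ S) {v : Fin G.n} (p : G.G.Walk G.s v)
    (hp : ∀ u ∈ p.support, Allowed S u) (i : ℕ) (hi : i ≤ p.length) :
    (data G).Reach S (i + 1) (p.getVert i) := by
  induction i with
  | zero =>
    refine (reach_succ S 0 _).2 ⟨.inl ?_, hp _ (p.getVert_mem_support 0)⟩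
    simp [Data.Reach, h0, data]
  | succ i ih =>
    exact (reach_succ S (i + 1) _).2 ⟨.inr ⟨_, (p.adj_getVert_succ (by omega)).symm,
      ih (by omega)⟩, hp _ (p.getVert_mem_support _)⟩

/-- There is a path with at most `k` colors if and only if the circuit has a satisfying assignment
of weight `k + 1`. -/
theorem hasValidPath_iff (k : ℕ) :
    G.HasValidPath k ↔ (Data.circuit k (data_valid G)).WeightedSat (k + 1) := by
  constructor
  · rintro ⟨p, hp, hk⟩
    set colors := p.support.toFinset.biUnion G.χ
    set T : Finset ℕ := insert 0 (colors.image fun c : Fin G.m => 1 + (c : ℕ))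
    have hT : T ⊆ Finset.range (1 + G.m + k) := by
      intro x hx
      simp only [T, Finset.mem_insert, Finset.mem_image] at hx
      rw [Finset.mem_range]
      obtain rfl | ⟨c, -, rfl⟩ := hx
      · omega
      · have := c.2
        omega
    have hTk : T.card ≤ k + 1 :=
      (Finset.card_insert_le _ _).trans (Nat.succ_le_succ (Finset.card_image_le.trans hk))
    -- The slack variables allow for the exact weight `k + 1`.
    obtain ⟨S, hTS, hS, hSk⟩ := Finset.exists_subsuperset_card_eq hT hTk (by simp)
    have h0 : 0 ∈ S := hTS (Finset.mem_insert_self _ _)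
    have hall : ∀ u ∈ p.support, Allowed S u := fun u hu c hc =>
      hTS (Finset.mem_insert_of_mem (Finset.mem_image_of_mem _
        (Finset.mem_biUnion.2 ⟨u, List.mem_toFinset.2 hu, hc⟩)))
    have hlen : p.length + 1 ≤ G.n := by simpa using hp.length_lt
    refine ⟨S, fun x hx => ⟨true, ?_⟩, hSk, (Data.value_output k S (data_valid G)).2 ⟨h0, ?_, ?_⟩⟩
    · exact List.mem_of_getElem? ((data G).nodes_variable k (Finset.mem_range.1 (hS hx)))
    · have := reach_of_walk h0 p hall 0 (Nat.zero_le _)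
      rw [SimpleGraph.Walk.getVert_zero] at this
      exact reach_mono (by simp [data]; omega) (hall _ p.start_mem_support) this
    · have := reach_of_walk h0 p hall p.length le_rfl
      rw [SimpleGraph.Walk.getVert_length] at this
      exact reach_mono hlen (hall _ p.end_mem_support) this
  · rintro ⟨S, -, hSk, hS⟩
    obtain ⟨h0, hs, ht⟩ := (Data.value_output k S (data_valid G)).1 hS
    -- The source is reached after `n > 0` rounds, so the last of them has tested its colors.
    have hsA : Allowed S G.s := by
      have hn : 0 < G.n := G.s.pos
      obtain ⟨l, hl⟩ : ∃ l, (data G).n = l + 1 := ⟨G.n - 1, by simp [data]; omega⟩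
      rw [hl] at hs
      exact ((reach_succ S l G.s).1 hs).2
    obtain ⟨p, hp⟩ := exists_walk_of_reach h0 hsA _ _ ht
    refine ⟨p.bypass, p.bypass_isPath, ?_⟩
    have hsub : (p.bypass.support.toFinset.biUnion G.χ).image (fun c : Fin G.m => 1 + (c : ℕ)) ⊆
        S.erase 0 := by
      intro x hx
      simp only [Finset.mem_image, Finset.mem_biUnion, List.mem_toFinset] at hx
      obtain ⟨c, ⟨u, hu, hc⟩, rfl⟩ := hx
      exact Finset.mem_erase.2 ⟨by omega, hp u (p.support_bypass_subset_support hu) c hc⟩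
    have := Finset.card_le_card hsub
    rw [Finset.card_erase_of_mem h0, hSk, Finset.card_image_of_injective _ fun a b h =>
      Fin.ext (Nat.add_left_cancel h)] at this
    exact this

/-! ### The encoding and the time bound -/

theorem map_some_unary (a : ℕ) : (ColoredGraph.unary a).map some = unaryBits a := by
  simp [ColoredGraph.unary, unaryBits]

theorem map_some_matrix {n q : ℕ} (P : Fin n → Fin q → Prop) (p : ℕ → ℕ → Bool)
    (h : ∀ (v : Fin n) (u : Fin q), p v u = true ↔ P v u) :
    ((List.finRange n).flatMap fun v => ColoredGraph.bits (P v)).map some = matrix n q p := by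
  rw [matrix, ← List.map_coe_finRange_eq_range, List.flatMap_map, List.map_flatMap]
  refine List.flatMap_congr fun v _ => ?_
  rw [ColoredGraph.bits, List.map_append, rowBits, ← List.map_coe_finRange_eq_range,
    List.ofFn_eq_map, List.map_map, List.map_map]
  refine congrArg₂ _ (List.map_congr_left fun u _ => ?_) rfl
  simp [← h]

theorem tape_eq_word (G : ColoredGraph) (k : ℕ) : coloredPath.tape G k = (data G).word k := by
  change List.replicate k (none : Option (Option Bool)) ++ G.code.map some = _
  rw [Data.word]
  refine congrArg (List.replicate k none ++ ·) ?_
  simp only [ColoredGraph.code, List.map_append, map_some_unary,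
    map_some_matrix _ _ (data_adj G), map_some_matrix _ _ (data_col G), List.append_assoc]
  rfl

theorem length_code (G : ColoredGraph) : G.n + G.m ≤ G.code.length := by
  simp [ColoredGraph.code, ColoredGraph.unary]
  omega

theorem primrec_bound : Primrec fun k : ℕ => 256000 * (k + 1) ^ 8 := by
  have h2 : ∀ {f : ℕ → ℕ}, Primrec f → Primrec fun k => f k * f k :=
    fun hf => Primrec.nat_mul.comp hf hf
  -- Three squarings give the eighth power.
  refine (Primrec.nat_mul.comp (Primrec.const 256000) (h2 (h2 (h2 Primrec.succ)))).of_eq ?_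
  intro k
  simp only [Nat.succ_eq_add_one]
  ring

end ColoredPath

theorem mainTheorem5 : coloredPath ∈ classWP := by
  refine ⟨⟨ColoredPath.program.machine ColoredPath.Stack.inp ColoredPath.Stack.out,
      Equiv.refl _, Equiv.refl _⟩, fun k => 256000 * (k + 1) ^ 8, fun k => k + 1, 8,
    ColoredPath.primrec_bound.to_comp, Primrec.succ.to_comp,
    fun G k => ⟨ColoredPath.Data.circuit k (ColoredPath.data_valid G), k + 1, ?_, le_rfl,
      ColoredPath.hasValidPath_iff k⟩⟩
  have hrun := ColoredPath.runs_program (ColoredPath.data G) k G.s.2 G.t.2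
  have hin : ColoredPath.Mem.stk
      ⟨(ColoredPath.data G).word k, [], [], [], ColoredPath.counters 0 0 0 0 0 0 0⟩ =
      Function.update (fun a : ColoredPath.Stack => ([] : List a.Sym)) .inp
        ((ColoredPath.data G).word k) := by
    funext a
    obtain _ | _ | _ | _ | c := a
    case cnt => cases c <;> rfl
    all_goals rfl
  have hout : ∀ l, ColoredPath.Mem.stk ⟨[], [], [], l, ColoredPath.counters 0 0 0 0 0 0 0⟩ =
      Function.update (fun a : ColoredPath.Stack => ([] : List a.Sym)) .out l := by
    intro l
    funext a
    obtain _ | _ | _ | _ | c := a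
    case cnt => cases c <;> rfl
    all_goals rfl
  have htime : 256000 * (G.n + G.m + k + 1) ^ 8 ≤
      256000 * (k + 1) ^ 8 * (G.code.length + 1) ^ 8 := by
    have h : G.n + G.m + k + 1 ≤ (k + 1) * (G.code.length + 1) := by
      have := ColoredPath.length_code G
      nlinarith [Nat.zero_le (k * G.code.length)]
    rw [mul_assoc, ← mul_pow]
    exact Nat.mul_le_mul_left _ (Nat.pow_le_pow_left h 8)
  replace hrun := (hrun : StackProg.Run _ _ _ _).mono htime
  rw [hin, hout] at hrun
  exact (congrArg₂ (fun a b => Nonempty (Turing.TM2OutputsInTime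
      (ColoredPath.program.machine ColoredPath.Stack.inp ColoredPath.Stack.out) a (some b) _))
    ((List.map_id _).trans (ColoredPath.tape_eq_word G k)) (List.map_id _)).mpr hrun.outputsInTime
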